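/- **Theorem 3.4.** All cubes are closed, nondegenerate, with sides parallel to the axes; $tQ$ is the cube concentric with $Q$ whose side is $t$ times as long; $\omega(E)=\int_E\omega\,dx$. Let $n\ge 1$, $1<q<p<\infty$, $0<\beta<1<\alpha$, $\eta>q/p$, $C_1,C_2>0$ and $C_3,K\ge 0$. There is a constant $C>0$, depending only on $n,p,q,\alpha,\beta,\eta,C_1,C_2,C_3,K$, with the following property. Let $Q_0$ be a cube in $\mathbb R^n$, $F\in L^1(2Q_0)$ and $f\in L^q(2Q_0)$ real-valued functions. Suppose that for each dyadic subcube $Q$ of $Q_0$ with $|Q|\le\beta|Q_0|$ and $\alpha Q\subset 2Q_0$ there exist two integrable functions $F_Q$ and $R_Q$ on $2Q$ such that $|F|\le|F_Q|+|R_Q|$ a.e. on $2Q$ and $$\Big\{\frac1{|2Q|}\int_{2Q}|R_Q|^p\,dx\Big\}^{1/p}\le C_1\Big\{\frac1{|\alpha Q|}\int_{\alpha Q}|F|\,dx+\sup_{Q\subset Q'\subset 2Q_0}\frac1{|Q'|}\int_{Q'}|f|\,dx\Big\},$$ $$\frac1{|2Q|}\int_{2Q}|F_Q|\,dx\le C_2\sup_{Q\subset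 Q'\subset 2Q_0}\frac1{|Q'|}\int_{Q'}|f|\,dx,$$ where the suprema are over cubes $Q'$. Let $\omega$ be an $A_q$ weight on $2Q_0$ with constant at most $K$, that is, $\omega$ is integrable and a.e. positive on $2Q_0$ and $$\Big(\frac1{|Q|}\int_Q\omega\,dx\Big)\Big(\frac1{|Q|}\int_Q\omega^{-1/(q-1)}\,dx\Big)^{q-1}\le K\quad\text{for every cube }Q\subset 2Q_0,$$ and suppose that for every cube $Q\subset Q_0$ and every measurable $E\subset Q$ $$\frac{\omega(E)}{\omega(Q)}\le C_3\Big(\frac{|E|}{|Q|}\Big)^{\eta}.$$ Then $$\Big\{\frac1{\omega(Q_0)}\int_{Q_0}|F|^q\,\omega\,dx\Big\}^{1/q}\le\frac{C}{|2Q_0|}\int_{2Q_0}|F|\,dx+C\Big\{\frac1{\omega(2Q_0)}\int_{2Q_0}|f|^q\,\omega\,dx\Big\}^{1/q},$$ where the last term may be $+\infty$, in which case the inequality is trivially true. -/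

import Mathlib

open MeasureTheory
open scoped ENNReal NNReal

/-- A (nondegenerate) cube in `ℝⁿ` with sides parallel to the coordinate axes. -/
structure AxisCube (n : ℕ) where
  center : Fin n → ℝ
  side : ℝ
  side_pos : 0 < side

namespace AxisCube

/-- The concentric dilate `tQ`, as a closed set: same center, side length `t * side`. -/
def dilate {n : ℕ} (Q : AxisCube n) (t : ℝ) : Set (Fin n → ℝ) :=
  {x | ∀ i, |x i - Q.center i| ≤ t * Q.side / 2}

/-- The closed cube itself, as a set. -/
def toSet {n : ℕ} (Q : AxisCube n) : Set (Fin n → ℝ) :=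
  {x | ∀ i, |x i - Q.center i| ≤ Q.side / 2}

/-- `Q` is a dyadic subcube of `Q₀`: it is one of the `2 ^ (k n)` cubes obtained by
bisecting the sides of `Q₀` successively `k` times, for some `k ≥ 0`. -/
def IsDyadicSubcube {n : ℕ} (Q Q₀ : AxisCube n) : Prop :=
  ∃ (k : ℕ) (j : Fin n → Fin (2 ^ k)),
    Q.side = Q₀.side / 2 ^ k ∧
    ∀ i, Q.center i =
      Q₀.center i - Q₀.side / 2 + (((j i : ℕ) : ℝ) + 1 / 2) * (Q₀.side / 2 ^ k)

/-- The supremum of the averages of `|f|` over all cubes `Q'` with `Q ⊆ Q' ⊆ S`. -/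
noncomputable def supAverage {n : ℕ} (Q : AxisCube n) (S : Set (Fin n → ℝ))
    (f : (Fin n → ℝ) → ℝ) : ℝ≥0∞ :=
  ⨆ (Q' : AxisCube n) (_ : Q.toSet ⊆ Q'.toSet) (_ : Q'.toSet ⊆ S),
    ⨍⁻ x in Q'.toSet, ‖f x‖ₑ ∂volume

end AxisCube

/-- `ω(E) = ∫_E ω dx`. -/
noncomputable def weightMass {n : ℕ} (ω : (Fin n → ℝ) → ℝ) (E : Set (Fin n → ℝ)) : ℝ≥0∞ :=
  ∫⁻ x in E, ENNReal.ofReal (ω x)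

/-- The weighted `L^q` average `((1 / ω(E)) ∫_E |g|^q ω dx)^(1/q)`. -/
noncomputable def weightedLqAverage {n : ℕ} (q : ℝ) (ω : (Fin n → ℝ) → ℝ)
    (E : Set (Fin n → ℝ)) (g : (Fin n → ℝ) → ℝ) : ℝ≥0∞ :=
  ((∫⁻ x in E, ‖g x‖ₑ ^ q * ENNReal.ofReal (ω x)) / weightMass ω E) ^ (1 / q)

/-- `ω` is an `A_q` weight on `S` with `A_q` constant at most `K`: it is integrable and almost
everywhere positive on `S`, and for every cube `Q ⊆ S`
`(⨍_Q ω) (⨍_Q ω^(-1/(q-1)))^(q-1) ≤ K`. -/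
structure IsMuckenhouptWeightOn {n : ℕ} (q : ℝ) (K : ℝ≥0) (S : Set (Fin n → ℝ))
    (ω : (Fin n → ℝ) → ℝ) : Prop where
  integrableOn : IntegrableOn ω S
  pos : ∀ᵐ x ∂(volume.restrict S), 0 < ω x
  bound : ∀ Q : AxisCube n, Q.toSet ⊆ S →
    (⨍⁻ x in Q.toSet, ENNReal.ofReal (ω x) ∂volume) *
      (⨍⁻ x in Q.toSet, ENNReal.ofReal (ω x) ^ (-(1 / (q - 1))) ∂volume) ^ (q - 1) ≤ (K : ℝ≥0∞)

/-! The proof is a good-λ argument. Let MF(x) be the supremum of the averages of |F| over the cubes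
in 2Q₀ that contain some dyadic subcube of Q₀ around x (`dyadicMaximal`), and let Mf be its analogue
for f. For λ above a multiple of the average of |F| over 2Q₀, the set {MF > λ} splits into maximal
dyadic cubes Q, all small enough for |F| ≤ |F_Q| + |R_Q| to be available. Since the parent of Q has
averages at most λ, a point of Q with MF > Aλ owes this to a cube inside 2Q, on which F_Q or R_Q
must be large. If moreover the averages of |f| over the cubes containing Q are at most γλ, the weak
(1,1) bound, applied to F_Q and to |R_Q|^p, shows that such points fill a fraction of Q of order γ/A
+ A^(-p) (`volume_le_of_local_decomposition`). The last hypothesis on ω turns this into an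
ω-fraction of order (γ/A + A^(-p))^η, and summing over Q gives the good-λ inequality
(`measure_lt_dyadicMaximal_le`, `goodLambda_dyadicMaximal`).

Integrating against λ^(q-1) costs a factor A^q. Since η > q/p, A^q A^(-pη) is small for large A;
with γ then chosen in terms of A (`exists_goodLambda_parameters`), the term in MF is absorbed
(`lintegral_rpow_le_of_goodLambda`). There remains ∫ (Mf)^q ω, which Muckenhoupt's theorem controls
(`IsRegularWeight.lintegral_rpow_mul_le`). That theorem is proved by composing two maximal
operators, one for the dual weight ω^(-1/(q-1)) and one for ω, each bounded because the A_q
condition makes both measures doubling.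

Finally |F| ≤ MF almost everywhere by Lebesgue differentiation, and doubling compares ω(2Q₀) with
ω(Q₀). All quantities live in [0, ∞], so an infinite right-hand side needs no separate case. -/

namespace AxisCube

/-! ### Cubes and the dyadic grid. -/

variable {n : ℕ}

/-- The norm on `Fin n → ℝ` is the sup norm; covering and differentiation theorems for balls thus
apply to cubes. -/
theorem toSet_eq_closedBall (Q : AxisCube n) :
    Q.toSet = Metric.closedBall Q.center (Q.side / 2) := by
  have h : 0 ≤ Q.side / 2 := by linarith [Q.side_pos]
  ext x
  simp [toSet, Metric.mem_closedBall, dist_pi_le_iff h, Real.dist_eq]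

/-- The concentric dilate of a cube, as a cube. -/
def scale (Q : AxisCube n) (t : ℝ) (ht : 0 < t) : AxisCube n :=
  ⟨Q.center, t * Q.side, mul_pos ht Q.side_pos⟩

theorem volume_toSet (Q : AxisCube n) : volume Q.toSet = ENNReal.ofReal (Q.side ^ n) := by
  rw [toSet_eq_closedBall, Real.volume_pi_closedBall _ (by linarith [Q.side_pos])]
  simp [mul_div_cancel₀]

theorem measurableSet_toSet (Q : AxisCube n) : MeasurableSet Q.toSet := by
  rw [toSet_eq_closedBall]; exact Metric.isClosed_closedBall.measurableSet

theorem volume_toSet_pos (Q : AxisCube n) : 0 < volume Q.toSet := by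
  rw [volume_toSet]; have := Q.side_pos; simp; positivity

theorem volume_toSet_ne_zero (Q : AxisCube n) : volume Q.toSet ≠ 0 := Q.volume_toSet_pos.ne'

theorem volume_toSet_ne_top (Q : AxisCube n) : volume Q.toSet ≠ ∞ := by
  rw [volume_toSet]; exact ENNReal.ofReal_ne_top

theorem volume_toSet_le_mul {Q Q' : AxisCube n} {a : ℝ} (ha : 0 ≤ a)
    (h : Q'.side ≤ a * Q.side) :
    volume Q'.toSet ≤ ENNReal.ofReal (a ^ n) * volume Q.toSet := by
  rw [volume_toSet, volume_toSet, ← ENNReal.ofReal_mul (by positivity), ← mul_pow]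
  exact ENNReal.ofReal_le_ofReal (pow_le_pow_left₀ Q'.side_pos.le h n)

theorem side_le_of_volume_le (hn : n ≠ 0) {Q Q' : AxisCube n} {a : ℝ} (ha : 0 ≤ a)
    (h : volume Q'.toSet ≤ ENNReal.ofReal (a ^ n) * volume Q.toSet) :
    Q'.side ≤ a * Q.side := by
  have := Q.side_pos
  rw [volume_toSet, volume_toSet, ← ENNReal.ofReal_mul (by positivity), ← mul_pow,
    ENNReal.ofReal_le_ofReal_iff (by positivity)] at h
  exact le_of_pow_le_pow_left₀ hn (by positivity) h

/-- The part of a closed ball that lies in a cube `T` is contained in a cube that is itself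
contained in `T` and is no larger than the ball. -/
theorem exists_cube_of_closedBall_inter (T : AxisCube n) (c : Fin n → ℝ) {ρ : ℝ} (hρ : 0 < ρ) :
    ∃ Q : AxisCube n, Q.side ≤ 2 * ρ ∧ Q.toSet ⊆ T.toSet ∧
      Metric.closedBall c ρ ∩ T.toSet ⊆ Q.toSet := by
  have hT := T.side_pos
  set r := min ρ (T.side / 2) with hr
  have hr0 : 0 < r := lt_min hρ (by linarith)
  have hr1 : r ≤ ρ := min_le_left _ _
  have hr2 : r ≤ T.side / 2 := min_le_right _ _
  -- The centre is moved, coordinate by coordinate, into the range where a cube of half-side r fits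
  -- inside T.
  refine ⟨⟨fun i => max (min (c i) (T.center i + T.side / 2 - r)) (T.center i - T.side / 2 + r),
    2 * r, by linarith⟩, by simpa using hr1, ?_, ?_⟩
  · intro x hx i
    have := hx i
    simp only [abs_le] at this ⊢
    have h1 := le_max_right (min (c i) (T.center i + T.side / 2 - r)) (T.center i - T.side / 2 + r)
    have h2 : max (min (c i) (T.center i + T.side / 2 - r)) (T.center i - T.side / 2 + r) ≤
        T.center i + T.side / 2 - r := max_le (min_le_right _ _) (by linarith)
    constructor <;> linarith
  · rintro x ⟨hx, hxT⟩ i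
    have h1 := hxT i
    have h2 : |x i - c i| ≤ ρ := by
      rw [← Real.dist_eq]; exact (dist_le_pi_dist x c i).trans hx
    simp only [abs_le] at h1 h2 ⊢
    have h3 : r = ρ ∨ r = T.side / 2 := min_choice _ _
    clear_value r
    grind

/-- The cube with index `j` of the `k`-th dyadic grid generated by `Q₀`. -/
noncomputable def gridCube (Q₀ : AxisCube n) (k : ℕ) (j : Fin n → ℤ) : AxisCube n :=
  ⟨fun i => Q₀.center i - Q₀.side / 2 + ((j i : ℝ) + 1 / 2) * (Q₀.side / 2 ^ k),
    Q₀.side / 2 ^ k, by have := Q₀.side_pos; positivity⟩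

/-- The index of the half-open cube of the `k`-th dyadic grid that contains `x`. -/
noncomputable def gridIndex (Q₀ : AxisCube n) (k : ℕ) (x : Fin n → ℝ) (i : Fin n) : ℤ :=
  ⌊(x i - (Q₀.center i - Q₀.side / 2)) / (Q₀.side / 2 ^ k)⌋

theorem measurable_gridIndex (Q₀ : AxisCube n) (k : ℕ) : Measurable (Q₀.gridIndex k) := by
  refine measurable_pi_lambda _ fun i => Int.measurable_floor.comp ?_
  fun_prop

theorem gridIndex_eq_iff (Q₀ : AxisCube n) (k : ℕ) (x : Fin n → ℝ) (j : Fin n → ℤ) :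
    Q₀.gridIndex k x = j ↔ ∀ i,
      (Q₀.gridCube k j).center i - (Q₀.gridCube k j).side / 2 ≤ x i ∧
        x i < (Q₀.gridCube k j).center i + (Q₀.gridCube k j).side / 2 := by
  have hs : 0 < Q₀.side / 2 ^ k := by have := Q₀.side_pos; positivity
  rw [funext_iff]
  refine forall_congr' fun i => ?_
  simp only [gridIndex, gridCube, Int.floor_eq_iff, le_div_iff₀ hs, div_lt_iff₀ hs]
  constructor <;> rintro ⟨h1, h2⟩ <;> constructor <;> nlinarith

theorem gridPiece_subset (Q₀ : AxisCube n) (k : ℕ) (j : Fin n → ℤ) :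
    {x | Q₀.gridIndex k x = j} ⊆ (Q₀.gridCube k j).toSet := by
  intro x hx i
  have := (Q₀.gridIndex_eq_iff k x j).1 hx i
  rw [abs_le]; constructor <;> linarith

theorem mem_gridCube_gridIndex (Q₀ : AxisCube n) (k : ℕ) (x : Fin n → ℝ) :
    x ∈ (Q₀.gridCube k (Q₀.gridIndex k x)).toSet :=
  Q₀.gridPiece_subset k _ rfl

theorem ball_subset_gridPiece (Q₀ : AxisCube n) (k : ℕ) (j : Fin n → ℤ) :
    Metric.ball (Q₀.gridCube k j).center ((Q₀.gridCube k j).side / 2) ⊆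
      {x | Q₀.gridIndex k x = j} := by
  intro x hx
  refine (Q₀.gridIndex_eq_iff k x j).2 fun i => ?_
  have h := (dist_le_pi_dist x (Q₀.gridCube k j).center i).trans_lt hx
  rw [Real.dist_eq, abs_lt] at h
  constructor <;> linarith

theorem ball_ae_eq_toSet (hn : n ≠ 0) (Q : AxisCube n) :
    Metric.ball Q.center (Q.side / 2) =ᵐ[volume] Q.toSet := by
  have : Nonempty (Fin n) := ⟨⟨0, Nat.pos_of_ne_zero hn⟩⟩
  rw [toSet_eq_closedBall, ← Metric.ball_union_sphere]
  have h := Measure.addHaar_sphere (volume : Measure (Fin n → ℝ)) Q.center (Q.side / 2)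
  exact (union_ae_eq_left_of_ae_eq_empty (ae_eq_empty.2 h)).symm

/-- Half-open pieces are used because they are disjoint, closed cubes because the hypotheses speak
of them; this allows passing between the two. -/
theorem gridPiece_ae_eq (hn : n ≠ 0) (Q₀ : AxisCube n) (k : ℕ) (j : Fin n → ℤ) :
    ({x | Q₀.gridIndex k x = j} : Set (Fin n → ℝ)) =ᵐ[volume] (Q₀.gridCube k j).toSet :=
  (Q₀.gridPiece_subset k j).eventuallyLE.antisymm
    ((ball_ae_eq_toSet hn _).symm.le.trans (Q₀.ball_subset_gridPiece k j).eventuallyLE)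

/-- The identity ⌊⌊y⌋ / 2⌋ = ⌊y / 2⌋: the index of the parent is half the index of the child,
rounded down. This is what makes the grids nested. -/
theorem gridIndex_succ_div_two (Q₀ : AxisCube n) (k : ℕ) (x : Fin n → ℝ) (i : Fin n) :
    Q₀.gridIndex (k + 1) x i / 2 = Q₀.gridIndex k x i := by
  have h := Int.floor_div_natCast
    ((x i - (Q₀.center i - Q₀.side / 2)) / (Q₀.side / 2 ^ (k + 1))) 2
  have hs := Q₀.side_pos.ne'
  rw [Nat.cast_ofNat, Nat.cast_ofNat] at h
  rw [gridIndex, gridIndex, ← h]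
  congr 1
  field_simp
  ring

theorem gridCube_succ_subset (Q₀ : AxisCube n) (k : ℕ) (j : Fin n → ℤ) :
    (Q₀.gridCube (k + 1) j).toSet ⊆ (Q₀.gridCube k fun i => j i / 2).toSet := by
  intro x hx i
  have h := hx i
  have hs : 0 < Q₀.side / 2 ^ (k + 1) := by have := Q₀.side_pos; positivity
  have e : Q₀.side / 2 ^ k = 2 * (Q₀.side / 2 ^ (k + 1)) := by field_simp; ring
  simp only [gridCube, e] at h ⊢
  set s := Q₀.side / 2 ^ (k + 1)
  have h1 : (2 * (j i / 2 : ℤ) : ℝ) ≤ j i := by exact_mod_cast (by omega)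
  have h2 : (j i : ℝ) ≤ 2 * (j i / 2 : ℤ) + 1 := by exact_mod_cast (by omega)
  rw [abs_le] at h ⊢
  constructor <;> nlinarith

theorem gridCube_gridIndex_antitone (Q₀ : AxisCube n) (x : Fin n → ℝ) :
    Antitone fun k => (Q₀.gridCube k (Q₀.gridIndex k x)).toSet := by
  refine antitone_nat_of_succ_le fun k => ?_
  have := Q₀.gridCube_succ_subset k (Q₀.gridIndex (k + 1) x)
  simpa only [gridIndex_succ_div_two] using this

theorem toSet_gridCube_zero (Q₀ : AxisCube n) : (Q₀.gridCube 0 0).toSet = Q₀.toSet := by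
  ext x
  simp only [toSet, gridCube, Set.mem_ofPred_eq]
  refine forall_congr' fun i => ?_
  simp only [Pi.zero_apply, Int.cast_zero, pow_zero, div_one]
  rw [show Q₀.center i - Q₀.side / 2 + (0 + 1 / 2) * Q₀.side = Q₀.center i by ring]

/-- The half-open version of a cube. -/
def halfOpen (Q₀ : AxisCube n) : Set (Fin n → ℝ) := {x | Q₀.gridIndex 0 x = 0}

theorem measurableSet_halfOpen (Q₀ : AxisCube n) : MeasurableSet Q₀.halfOpen :=
  Q₀.measurable_gridIndex 0 (measurableSet_singleton 0)

theorem halfOpen_subset (Q₀ : AxisCube n) : Q₀.halfOpen ⊆ Q₀.toSet := by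
  rw [← toSet_gridCube_zero]; exact Q₀.gridPiece_subset 0 0

theorem halfOpen_ae_eq (hn : n ≠ 0) (Q₀ : AxisCube n) : Q₀.halfOpen =ᵐ[volume] Q₀.toSet := by
  rw [← toSet_gridCube_zero]; exact Q₀.gridPiece_ae_eq hn 0 0

theorem gridCube_subset (Q₀ : AxisCube n) {x : Fin n → ℝ} (hx : x ∈ Q₀.halfOpen) (k : ℕ) :
    (Q₀.gridCube k (Q₀.gridIndex k x)).toSet ⊆ Q₀.toSet := by
  have := Q₀.gridCube_gridIndex_antitone x (Nat.zero_le k)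
  have hx' : Q₀.gridIndex 0 x = 0 := hx
  simpa only [hx', toSet_gridCube_zero] using this

theorem isDyadicSubcube_gridCube (Q₀ : AxisCube n) {x : Fin n → ℝ} (hx : x ∈ Q₀.halfOpen)
    (k : ℕ) : (Q₀.gridCube k (Q₀.gridIndex k x)).IsDyadicSubcube Q₀ := by
  have key : ∀ i, 0 ≤ Q₀.gridIndex k x i ∧ Q₀.gridIndex k x i < 2 ^ k := by
    intro i
    have h := (Q₀.gridIndex_eq_iff 0 x 0).1 hx i
    have hs := Q₀.side_pos
    simp only [gridCube, Pi.zero_apply, Int.cast_zero, pow_zero, div_one] at h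
    have hs' : 0 < Q₀.side / 2 ^ k := by positivity
    refine ⟨Int.floor_nonneg.2 (div_nonneg (by linarith) hs'.le), Int.floor_lt.2 ?_⟩
    rw [div_lt_iff₀ hs']
    push_cast
    rw [mul_div_cancel₀ _ (by positivity)]
    linarith
  refine ⟨k, fun i => ⟨(Q₀.gridIndex k x i).toNat, ?_⟩, rfl, fun i => ?_⟩
  · have := key i
    zify
    rw [Int.toNat_of_nonneg this.1]
    exact this.2
  · have : (((Q₀.gridIndex k x i).toNat : ℕ) : ℝ) = (Q₀.gridIndex k x i : ℝ) := by
      exact_mod_cast Int.toNat_of_nonneg (key i).1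
    simp only [gridCube, this]

theorem supAverage_anti {Q Q' : AxisCube n} (h : Q.toSet ⊆ Q'.toSet) (S : Set (Fin n → ℝ))
    (f : (Fin n → ℝ) → ℝ) : Q'.supAverage S f ≤ Q.supAverage S f := by
  refine iSup_mono fun P => ?_
  exact iSup_le fun hP => iSup_le fun hS => le_iSup₂_of_le (h.trans hP) hS le_rfl

end AxisCube

/-! ### Layer cake and integration of a good-λ inequality. -/

/-- The inner integral of the layer cake formula. The value a = ∞ is included because maximal
functions may be infinite. -/
theorem setLIntegral_layer_rpow {s : ℝ} (hs : 0 < s) (a : ℝ≥0∞) :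
    ∫⁻ t in Set.Ioi (0 : ℝ), {t : ℝ | ENNReal.ofReal t < a}.indicator
      (fun t => ENNReal.ofReal (s * t ^ (s - 1))) t = a ^ s := by
  have meas : ∀ a : ℝ≥0∞, MeasurableSet {t : ℝ | ENNReal.ofReal t < a} := fun a =>
    measurableSet_lt ENNReal.measurable_ofReal measurable_const
  have fin : ∀ b : ℝ≥0, ∫⁻ t in Set.Ioi (0 : ℝ), {t : ℝ | ENNReal.ofReal t < b}.indicator
      (fun t => ENNReal.ofReal (s * t ^ (s - 1))) t = (b : ℝ≥0∞) ^ s := by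
    intro b
    have hb : (0 : ℝ) ≤ b := b.2
    rw [setLIntegral_indicator (meas b)]
    have hset : {t : ℝ | ENNReal.ofReal t < b} ∩ Set.Ioi 0 = Set.Ioo 0 (b : ℝ) := by
      ext t
      simp only [Set.mem_inter_iff, Set.mem_ofPred_eq, Set.mem_Ioi, Set.mem_Ioo]
      constructor
      · rintro ⟨h1, h2⟩
        refine ⟨h2, ?_⟩
        rwa [← ENNReal.ofReal_coe_nnreal, ENNReal.ofReal_lt_ofReal_iff_of_nonneg h2.le] at h1
      · rintro ⟨h1, h2⟩
        refine ⟨?_, h1⟩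
        rwa [← ENNReal.ofReal_coe_nnreal, ENNReal.ofReal_lt_ofReal_iff_of_nonneg h1.le]
    rw [hset, restrict_Ioo_eq_restrict_Ioc]
    -- The exponent s - 1 may be negative; s > 0 keeps the power integrable at 0.
    have hi : IntervalIntegrable (fun t : ℝ => s * t ^ (s - 1)) volume 0 b :=
      (intervalIntegral.intervalIntegrable_rpow' (by linarith)).const_mul s
    rw [intervalIntegrable_iff_integrableOn_Ioc_of_le hb] at hi
    rw [← ofReal_integral_eq_lintegral_ofReal hi, ← intervalIntegral.integral_of_le hb,
      intervalIntegral.integral_const_mul, integral_rpow (Or.inl (by linarith))]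
    · rw [sub_add_cancel, Real.zero_rpow hs.ne', sub_zero, mul_div_cancel₀ _ hs.ne',
        ← ENNReal.ofReal_rpow_of_nonneg hb hs.le, ENNReal.ofReal_coe_nnreal]
    · filter_upwards [ae_restrict_mem measurableSet_Ioc] with t ht
      have := ht.1
      positivity
  induction a with
  | coe b => exact fin b
  | top =>
    rw [ENNReal.top_rpow_of_pos hs]
    refine ENNReal.eq_top_of_forall_nnreal_le fun r => ?_
    -- The level r^(1/s) has s-th power r, so the integral is at least every finite r.
    have h := fin (r ^ (1 / s))
    rw [← ENNReal.coe_rpow_of_nonneg _ hs.le, ← NNReal.rpow_mul,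
      one_div_mul_cancel hs.ne', NNReal.rpow_one] at h
    rw [← h]
    refine lintegral_mono fun t => ?_
    exact Set.indicator_le_indicator_of_subset (fun t _ => by simp) (fun _ => zero_le) t

/-- The layer cake formula for powers of extended nonnegative functions. -/
theorem lintegral_rpow_eq_layer {X : Type*} [MeasurableSpace X] (μ : Measure X) [SFinite μ]
    {h : X → ℝ≥0∞} (hh : Measurable h) {s : ℝ} (hs : 0 < s) :
    ∫⁻ x, h x ^ s ∂μ = ∫⁻ t in Set.Ioi (0 : ℝ),
      μ {x | ENNReal.ofReal t < h x} * ENNReal.ofReal (s * t ^ (s - 1)) := by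
  have hm : MeasurableSet {z : X × ℝ | ENNReal.ofReal z.2 < h z.1} :=
    measurableSet_lt (by fun_prop) (by fun_prop)
  calc ∫⁻ x, h x ^ s ∂μ
      = ∫⁻ x, (∫⁻ t in Set.Ioi (0 : ℝ), {z : X × ℝ | ENNReal.ofReal z.2 < h z.1}.indicator
          (fun z => ENNReal.ofReal (s * z.2 ^ (s - 1))) (x, t)) ∂μ := by
        refine lintegral_congr fun x => ?_
        rw [← setLIntegral_layer_rpow hs]
        rfl
    _ = ∫⁻ t in Set.Ioi (0 : ℝ), (∫⁻ x, {z : X × ℝ | ENNReal.ofReal z.2 < h z.1}.indicator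
          (fun z => ENNReal.ofReal (s * z.2 ^ (s - 1))) (x, t) ∂μ) := by
        refine lintegral_lintegral_swap (Measurable.aemeasurable ?_)
        exact Measurable.indicator (by fun_prop) hm
    _ = _ := by
        refine lintegral_congr fun t => ?_
        have : MeasurableSet {x | ENNReal.ofReal t < h x} :=
          measurableSet_lt measurable_const hh
        rw [mul_comm, ← lintegral_indicator_const this]
        rfl

/-- A good-`λ` inequality for distribution functions bounds the `L^q` norm. -/
theorem lintegral_rpow_le_of_goodLambda {X : Type*} [MeasurableSpace X] (μ : Measure X)
    [IsFiniteMeasure μ] {h m : X → ℝ≥0∞} (hh : Measurable h) (hm : Measurable m)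
    {q : ℝ} (hq : 0 < q) {A : ℝ≥0} (hA : 1 ≤ A) {l₀ : ℝ≥0} {θ : ℝ≥0∞}
    (hθ : (A : ℝ≥0∞) ^ q * θ ≤ 1 / 2)
    (H : ∀ t : ℝ≥0, l₀ < t →
      μ {x | A * t < h x} ≤ θ * μ {x | t < h x} + μ {x | t < m x}) :
    ∫⁻ x, h x ^ q ∂μ ≤
      2 * (A : ℝ≥0∞) ^ q * (l₀ ^ q * μ Set.univ + ∫⁻ x, m x ^ q ∂μ) := by
  have hA0 : (A : ℝ≥0∞) ≠ 0 := by
    simpa using (zero_lt_one.trans_le hA).ne'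
  -- The term to be absorbed must be finite, hence the truncation at N, which monotone convergence
  -- removes at the end.
  have trunc : ∀ N : ℕ, ∫⁻ x, min (h x) N ^ q ∂μ ≤
      2 * (A : ℝ≥0∞) ^ q * (l₀ ^ q * μ Set.univ + ∫⁻ x, m x ^ q ∂μ) := by
    intro N
    set g : X → ℝ≥0∞ := fun x => min (h x) N with hg
    have hgm : Measurable g := hh.min measurable_const
    have hfin : ∫⁻ x, g x ^ q ∂μ ≠ ∞ := by
      refine ne_top_of_le_ne_top (b := (N : ℝ≥0∞) ^ q * μ Set.univ) ?_ ?_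
      · exact ENNReal.mul_ne_top (ENNReal.rpow_ne_top_of_nonneg hq.le (by simp))
          (measure_ne_top _ _)
      · rw [← lintegral_const]
        exact lintegral_mono fun x => ENNReal.rpow_le_rpow (min_le_right _ _) hq.le
    -- Dividing by A turns the level A * t into t. Below l₀ the total mass is bound enough, and the
    -- single value t = l₀, about which `H` says nothing, is a null set.
    have step : ∀ t : ℝ, 0 < t → t ≠ l₀ → μ {x | ENNReal.ofReal t < g x / A} ≤
        {t : ℝ | ENNReal.ofReal t < l₀}.indicator (fun _ => μ Set.univ) t +
        (θ * μ {x | ENNReal.ofReal t < g x} + μ {x | ENNReal.ofReal t < m x}) := by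
      intro t ht hne
      rcases lt_trichotomy (ENNReal.ofReal t) l₀ with h0 | h0 | h0
      · rw [Set.indicator_of_mem (s := {t : ℝ | ENNReal.ofReal t < l₀}) h0]
        exact (measure_mono (Set.subset_univ _)).trans le_self_add
      · rw [← ENNReal.ofReal_coe_nnreal, ENNReal.ofReal_eq_ofReal_iff ht.le l₀.coe_nonneg] at h0
        exact absurd h0 hne
      · refine le_trans ?_ le_add_self
        lift t to ℝ≥0 using ht.le
        rw [ENNReal.ofReal_coe_nnreal] at h0 ⊢
        have hset : ∀ x, ((t : ℝ≥0∞) < g x / A ↔ A * t < h x ∧ (A * t : ℝ≥0∞) < N) := by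
          intro x
          rw [ENNReal.lt_div_iff_mul_lt (Or.inl hA0) (Or.inl ENNReal.coe_ne_top), mul_comm,
            hg, lt_min_iff]
        simp only [hset]
        by_cases hN : (A * t : ℝ≥0∞) < N
        · simp only [hN, and_true]
          have htN : (t : ℝ≥0∞) < N := lt_of_le_of_lt
            (by exact_mod_cast le_mul_of_one_le_left zero_le hA) hN
          have : ∀ x, ((t : ℝ≥0∞) < g x ↔ t < h x) := fun x => by simp [hg, htN]
          simp only [this]
          exact H t (by exact_mod_cast h0)
        · simp [hN]
    have hl : ∫⁻ x, (g x / A) ^ q ∂μ ≤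
        l₀ ^ q * μ Set.univ + (θ * ∫⁻ x, g x ^ q ∂μ + ∫⁻ x, m x ^ q ∂μ) := by
      rw [lintegral_rpow_eq_layer μ (hgm.div_const _) hq, lintegral_rpow_eq_layer μ hgm hq,
        lintegral_rpow_eq_layer μ hm hq]
      set k : ℝ → ℝ≥0∞ := fun t => ENNReal.ofReal (q * t ^ (q - 1)) with hk
      have hkm : Measurable k := by fun_prop
      have mono : ∀ u : X → ℝ≥0∞, Measurable fun t : ℝ => μ {x | ENNReal.ofReal t < u x} := by
        intro u
        refine Antitone.measurable fun a b hab => measure_mono fun x hx => ?_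
        exact lt_of_le_of_lt (ENNReal.ofReal_le_ofReal hab) hx
      have hgk : ∀ u : X → ℝ≥0∞,
          Measurable fun t : ℝ => μ {x | ENNReal.ofReal t < u x} * k t :=
        fun u => (mono u).mul hkm
      have hms : MeasurableSet {t : ℝ | ENNReal.ofReal t < l₀} :=
        measurableSet_lt ENNReal.measurable_ofReal measurable_const
      calc _ ≤ ∫⁻ t in Set.Ioi (0 : ℝ),
            ({t : ℝ | ENNReal.ofReal t < l₀}.indicator k t * μ Set.univ +
              (θ * (μ {x | ENNReal.ofReal t < g x} * k t) +
                μ {x | ENNReal.ofReal t < m x} * k t)) := by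
            refine lintegral_mono_ae ?_
            have hne : ∀ᵐ t : ℝ ∂volume.restrict (Set.Ioi 0), t ≠ l₀ :=
              ae_restrict_of_ae (Measure.ae_ne volume (l₀ : ℝ))
            filter_upwards [ae_restrict_mem measurableSet_Ioi, hne] with t ht hne
            refine (mul_le_mul_left (step t ht hne) (k t)).trans (le_of_eq ?_)
            rw [add_mul, add_mul, mul_assoc]
            congr 1
            by_cases h' : t ∈ {t : ℝ | ENNReal.ofReal t < l₀}
            · rw [Set.indicator_of_mem h', Set.indicator_of_mem h', mul_comm]
            · rw [Set.indicator_of_notMem h', Set.indicator_of_notMem h', zero_mul, zero_mul]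
        _ = _ := by
            rw [lintegral_add_left ((hkm.indicator hms).mul_const _),
              lintegral_add_left ((hgk g).const_mul _),
              lintegral_mul_const _ (hkm.indicator hms), setLIntegral_layer_rpow hq,
              lintegral_const_mul _ (hgk g)]
    have hAq : (A : ℝ≥0∞) ^ q ≠ 0 := by
      simp [ENNReal.rpow_eq_zero_iff, hA0]
    have hAq' : (A : ℝ≥0∞) ^ q ≠ ∞ := ENNReal.rpow_ne_top_of_nonneg hq.le ENNReal.coe_ne_top
    have hsc : ∫⁻ x, g x ^ q ∂μ = (A : ℝ≥0∞) ^ q * ∫⁻ x, (g x / A) ^ q ∂μ := by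
      rw [← lintegral_const_mul _ ((hgm.div_const _).pow_const _)]
      refine lintegral_congr fun x => ?_
      rw [ENNReal.div_rpow_of_nonneg _ _ hq.le, ENNReal.mul_div_cancel hAq hAq']
    have hfinal : ∫⁻ x, g x ^ q ∂μ ≤ (A : ℝ≥0∞) ^ q * (l₀ ^ q * μ Set.univ + ∫⁻ x, m x ^ q ∂μ) +
        (1 / 2) * ∫⁻ x, g x ^ q ∂μ := by
      calc ∫⁻ x, g x ^ q ∂μ = (A : ℝ≥0∞) ^ q * ∫⁻ x, (g x / A) ^ q ∂μ := hsc
        _ ≤ (A : ℝ≥0∞) ^ q *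
            (l₀ ^ q * μ Set.univ + (θ * ∫⁻ x, g x ^ q ∂μ + ∫⁻ x, m x ^ q ∂μ)) := by gcongr
        _ = (A : ℝ≥0∞) ^ q * (l₀ ^ q * μ Set.univ + ∫⁻ x, m x ^ q ∂μ) +
            ((A : ℝ≥0∞) ^ q * θ) * ∫⁻ x, g x ^ q ∂μ := by ring
        _ ≤ _ := by gcongr
    have hhalf : ∫⁻ x, g x ^ q ∂μ =
        (1 / 2) * ∫⁻ x, g x ^ q ∂μ + (1 / 2) * ∫⁻ x, g x ^ q ∂μ := by
      rw [← add_mul, ENNReal.add_halves, one_mul]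
    have h2 := ENNReal.le_of_add_le_add_right
      (ENNReal.mul_ne_top (by simp) hfin) (hhalf.symm.trans_le hfinal)
    calc ∫⁻ x, g x ^ q ∂μ = 2 * ((1 / 2) * ∫⁻ x, g x ^ q ∂μ) := by
          rw [← mul_assoc, one_div, ENNReal.mul_inv_cancel (by simp) (by simp), one_mul]
      _ ≤ 2 * ((A : ℝ≥0∞) ^ q * (l₀ ^ q * μ Set.univ + ∫⁻ x, m x ^ q ∂μ)) := by
          gcongr
      _ = _ := by ring
  have hsup : ∀ x, h x ^ q = ⨆ N : ℕ, min (h x) N ^ q := by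
    intro x
    have h1 : h x = ⨆ N : ℕ, min (h x) N := by
      rw [← inf_iSup_eq, ENNReal.iSup_natCast, inf_top_eq]
    conv_lhs => rw [h1]
    exact (ENNReal.orderIsoRpow q hq).map_iSup _
  simp only [hsup]
  rw [lintegral_iSup (fun N => (hh.min measurable_const).pow_const _)]
  · exact iSup_le trunc
  · intro N M hNM x
    exact ENNReal.rpow_le_rpow (min_le_min_left _ (by exact_mod_cast hNM)) hq.le

/-! ### Weak and strong type maximal inequalities for doubling measures. -/

namespace AxisCube

variable {n : ℕ}

/-- The weak type estimate for the noncentred maximal operator over the subcubes of `T`, stated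
for a set that is covered by cubes on which the average of `g` is at least `t`. -/
theorem mul_measure_le_of_covered (hn : n ≠ 0) (T : AxisCube n) (μ : Measure (Fin n → ℝ))
    {D : ℝ≥0∞}
    (hD : ∀ Q Q' : AxisCube n, Q.toSet ⊆ Q'.toSet → Q'.toSet ⊆ T.toSet → Q'.side ≤ 5 * Q.side →
      μ Q'.toSet ≤ D * μ Q.toSet)
    {E : Set (Fin n → ℝ)} {t : ℝ≥0∞} {g : (Fin n → ℝ) → ℝ≥0∞}
    (hE : ∀ x ∈ E, ∃ Q : AxisCube n, x ∈ Q.toSet ∧ Q.toSet ⊆ T.toSet ∧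
      t * μ Q.toSet ≤ ∫⁻ y in Q.toSet, g y ∂μ) :
    t * μ E ≤ D * ∫⁻ y in T.toSet, g y ∂μ := by
  have : Nonempty (AxisCube n) := ⟨T⟩
  choose! Q hxQ hQT hQ using hE
  have hside : ∀ x ∈ E, (Q x).side / 2 ≤ T.side / 2 := fun x hx => by
    have := side_le_of_volume_le hn (Q := T) (Q' := Q x) (a := 1) zero_le_one
      (by simpa using measure_mono (hQT x hx))
    linarith
  obtain ⟨u, huE, hdisj, hcov⟩ := Vitali.exists_disjoint_subfamily_covering_enlargement_closedBall
    E (fun x => (Q x).center) (fun x => (Q x).side / 2) (T.side / 2) hside 5 (by norm_num)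
  simp only [← toSet_eq_closedBall] at hdisj hcov
  have hcount : u.Countable := by
    refine hdisj.countable_of_nonempty_interior fun x _ => ?_
    rw [toSet_eq_closedBall]
    exact ⟨(Q x).center, interior_maximal Metric.ball_subset_closedBall Metric.isOpen_ball
      (Metric.mem_ball_self (by linarith [(Q x).side_pos]))⟩
  -- The fivefold enlargement may leave T, where μ is not controlled. Only its part in T matters,
  -- and this part lies in a subcube of T whose side is at most five times as long.
  have big : ∀ x ∈ u, μ (Metric.closedBall (Q x).center (5 * ((Q x).side / 2)) ∩ T.toSet) ≤
      D * μ (Q x).toSet := by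
    intro x hx
    have hpos := (Q x).side_pos
    obtain ⟨Q', h1, h2, h3⟩ := T.exists_cube_of_closedBall_inter (Q x).center
      (ρ := 5 * ((Q x).side / 2)) (by linarith)
    refine (measure_mono h3).trans (hD _ _ ?_ h2 (by linarith))
    refine Set.Subset.trans (Set.subset_inter ?_ (hQT x (huE hx))) h3
    rw [toSet_eq_closedBall]
    exact Metric.closedBall_subset_closedBall (by linarith)
  have hEsub : E ⊆ ⋃ x ∈ u,
      (Metric.closedBall (Q x).center (5 * ((Q x).side / 2)) ∩ T.toSet) := by
    intro x hx
    obtain ⟨b, hb, hsub⟩ := hcov x hx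
    exact Set.mem_biUnion hb ⟨hsub (hxQ x hx), hQT x hx (hxQ x hx)⟩
  calc t * μ E ≤ t * ∑' x : u, D * μ (Q x).toSet := by
        gcongr
        refine (measure_mono hEsub).trans ((measure_biUnion_le μ hcount _).trans ?_)
        exact ENNReal.tsum_le_tsum fun x => big x x.2
    _ = D * ∑' x : u, t * μ (Q x).toSet := by
        rw [ENNReal.tsum_mul_left, ENNReal.tsum_mul_left]; ring
    _ ≤ D * ∑' x : u, ∫⁻ y in (Q x).toSet, g y ∂μ := by
        gcongr with x
        exact hQ x (huE x.2)
    _ = D * ∫⁻ y in ⋃ x ∈ u, (Q x).toSet, g y ∂μ := by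
        rw [lintegral_biUnion hcount (fun x _ => (Q x).measurableSet_toSet) hdisj]
    _ ≤ _ := by
        gcongr
        exact Set.iUnion₂_subset fun x hx => hQT x (huE hx)

/-- The constant in the strong type estimate for maximal functions. -/
noncomputable def strongTypeConst (D : ℝ≥0∞) (r : ℝ) : ℝ≥0∞ :=
  2 * D * ENNReal.ofReal (r / (r - 1)) * 2 ^ (r - 1)

theorem strongTypeConst_ne_top {D : ℝ≥0∞} (hD : D ≠ ∞) {r : ℝ} (hr : 1 < r) :
    strongTypeConst D r ≠ ∞ := by
  refine ENNReal.mul_ne_top (ENNReal.mul_ne_top (ENNReal.mul_ne_top (by simp) hD)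
    ENNReal.ofReal_ne_top) (ENNReal.rpow_ne_top_of_nonneg (by linarith) (by simp))

/-- The strong type estimate for the noncentred maximal operator over the subcubes of `T`, with
respect to a measure that is doubling on these cubes. -/
theorem lintegral_rpow_le_of_le_maximal (hn : n ≠ 0) (T : AxisCube n) (μ : Measure (Fin n → ℝ))
    [SFinite μ] (hfin : ∀ Q : AxisCube n, Q.toSet ⊆ T.toSet → μ Q.toSet ≠ ∞) {D : ℝ≥0∞}
    (hD : ∀ Q Q' : AxisCube n, Q.toSet ⊆ Q'.toSet → Q'.toSet ⊆ T.toSet → Q'.side ≤ 5 * Q.side →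
      μ Q'.toSet ≤ D * μ Q.toSet)
    {h g : (Fin n → ℝ) → ℝ≥0∞} (hh : Measurable h) (hg : Measurable g)
    (hgh : ∀ x, ∀ t : ℝ≥0, t < h x → ∃ Q : AxisCube n, x ∈ Q.toSet ∧ Q.toSet ⊆ T.toSet ∧
      t * μ Q.toSet ≤ ∫⁻ y in Q.toSet, g y ∂μ) {r : ℝ} (hr : 1 < r) :
    ∫⁻ x, h x ^ r ∂μ ≤ strongTypeConst D r * ∫⁻ x in T.toSet, g x ^ r ∂μ := by
  -- Building g into the measure lowers the exponent: ∫ (2g)^(r-1) dν is a constant times the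
  -- integral of g^r over T.
  set ν : Measure (Fin n → ℝ) := (μ.restrict T.toSet).withDensity g with hν
  have hr1 : 0 < r - 1 := by linarith
  have weak : ∀ t : ℝ, 0 < t → μ {x | ENNReal.ofReal t < h x} * ENNReal.ofReal (r * t ^ (r - 1)) ≤
      2 * D * ENNReal.ofReal (r / (r - 1)) * (ν {x | ENNReal.ofReal t < 2 * g x} *
        ENNReal.ofReal ((r - 1) * t ^ (r - 1 - 1))) := by
    intro t ht
    have ht2 : ENNReal.ofReal (t / 2) = ENNReal.ofReal t / 2 := by
      rw [ENNReal.ofReal_div_of_pos (by norm_num)]; simp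
    set G : Set (Fin n → ℝ) := {x | ENNReal.ofReal t < 2 * g x} with hG
    have hGm : MeasurableSet G := measurableSet_lt measurable_const (hg.const_mul 2)
    have key : ENNReal.ofReal (t / 2) * μ {x | ENNReal.ofReal t < h x} ≤
        D * ∫⁻ y in T.toSet, G.indicator g y ∂μ := by
      refine T.mul_measure_le_of_covered hn μ hD fun x hx => ?_
      obtain ⟨Q, hxQ, hQT, hQ⟩ := hgh x t.toNNReal hx
      refine ⟨Q, hxQ, hQT, ?_⟩
      change ENNReal.ofReal t * μ Q.toSet ≤ _ at hQ
      -- The part of g below t/2 contributes at most half of t * μ Q and can be subtracted.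
      have hle : ∀ y, g y ≤ G.indicator g y + ENNReal.ofReal (t / 2) := by
        intro y
        by_cases hy : y ∈ G
        · rw [Set.indicator_of_mem hy]; exact le_self_add
        · rw [Set.indicator_of_notMem hy, zero_add, ht2,
            ENNReal.le_div_iff_mul_le (by simp) (by simp), mul_comm]
          exact not_lt.1 hy
      have h1 : ∫⁻ y in Q.toSet, g y ∂μ ≤
          ∫⁻ y in Q.toSet, G.indicator g y ∂μ + ENNReal.ofReal (t / 2) * μ Q.toSet := by
        refine (lintegral_mono hle).trans (le_of_eq ?_)
        rw [lintegral_add_right _ measurable_const, setLIntegral_const]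
      have h2 : ENNReal.ofReal t * μ Q.toSet =
          ENNReal.ofReal (t / 2) * μ Q.toSet + ENNReal.ofReal (t / 2) * μ Q.toSet := by
        rw [← add_mul, ht2, ENNReal.add_halves]
      rw [h2] at hQ
      exact ENNReal.le_of_add_le_add_right
        (ENNReal.mul_ne_top ENNReal.ofReal_ne_top (hfin Q hQT)) (hQ.trans h1)
    have hνG : ∫⁻ y in T.toSet, G.indicator g y ∂μ = ν G := by
      rw [hν, withDensity_apply _ hGm, lintegral_indicator hGm]
    rw [hνG] at key
    have e : ENNReal.ofReal (r * t ^ (r - 1)) = ENNReal.ofReal (t / 2) *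
        (2 * ENNReal.ofReal (r / (r - 1)) * ENNReal.ofReal ((r - 1) * t ^ (r - 1 - 1))) := by
      rw [← ENNReal.ofReal_ofNat 2, ← ENNReal.ofReal_mul (by norm_num),
        ← ENNReal.ofReal_mul (by positivity), ← ENNReal.ofReal_mul (by positivity)]
      congr 1
      rw [Real.rpow_sub_one ht.ne' (r - 1)]
      field_simp
    calc _ = ENNReal.ofReal (t / 2) * μ {x | ENNReal.ofReal t < h x} *
          (2 * ENNReal.ofReal (r / (r - 1)) * ENNReal.ofReal ((r - 1) * t ^ (r - 1 - 1))) := by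
          rw [e]; ring
      _ ≤ D * ν G *
          (2 * ENNReal.ofReal (r / (r - 1)) * ENNReal.ofReal ((r - 1) * t ^ (r - 1 - 1))) := by
          gcongr
      _ = _ := by ring
  have hmono : Measurable fun t : ℝ => ν {x | ENNReal.ofReal t < 2 * g x} := by
    refine Antitone.measurable fun a b hab => measure_mono fun x hx => ?_
    exact lt_of_le_of_lt (ENNReal.ofReal_le_ofReal hab) hx
  have hprod : Measurable fun t : ℝ => ν {x | ENNReal.ofReal t < 2 * g x} *
      ENNReal.ofReal ((r - 1) * t ^ (r - 1 - 1)) := hmono.mul (by fun_prop)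
  calc ∫⁻ x, h x ^ r ∂μ
      = ∫⁻ t in Set.Ioi (0 : ℝ),
          μ {x | ENNReal.ofReal t < h x} * ENNReal.ofReal (r * t ^ (r - 1)) :=
        lintegral_rpow_eq_layer μ hh (by linarith)
    _ ≤ ∫⁻ t in Set.Ioi (0 : ℝ), 2 * D * ENNReal.ofReal (r / (r - 1)) *
          (ν {x | ENNReal.ofReal t < 2 * g x} *
            ENNReal.ofReal ((r - 1) * t ^ (r - 1 - 1))) :=
        setLIntegral_mono' measurableSet_Ioi weak
    _ = 2 * D * ENNReal.ofReal (r / (r - 1)) * ∫⁻ x, (2 * g x) ^ (r - 1) ∂ν := by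
        rw [lintegral_const_mul _ hprod,
          lintegral_rpow_eq_layer ν (hg.const_mul 2) hr1]
    _ = strongTypeConst D r * ∫⁻ x in T.toSet, g x ^ r ∂μ := by
        rw [hν, lintegral_withDensity_eq_lintegral_mul _ hg ((hg.const_mul 2).pow_const _),
          strongTypeConst, mul_assoc _ ((2 : ℝ≥0∞) ^ (r - 1)),
          ← lintegral_const_mul _ (hg.pow_const _)]
        congr 1
        refine lintegral_congr fun x => ?_
        rw [Pi.mul_apply, ENNReal.mul_rpow_of_nonneg _ _ hr1.le, mul_left_comm]
        congr 1
        conv_rhs => rw [show r = 1 + (r - 1) by ring,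
          ENNReal.rpow_add_of_nonneg _ _ zero_le_one hr1.le, ENNReal.rpow_one]

/-! ### A_q weights and Muckenhoupt's theorem. -/

/-- A measurable, everywhere positive and finite weight that satisfies the `A_q` condition on the
subcubes of `T`. -/
structure IsRegularWeight (q : ℝ) (K : ℝ≥0) (T : AxisCube n) (w : (Fin n → ℝ) → ℝ≥0∞) :
    Prop where
  one_lt : 1 < q
  measurable : Measurable w
  ne_zero : ∀ x, w x ≠ 0
  ne_top : ∀ x, w x ≠ ∞
  lintegral_ne_top : ∫⁻ x in T.toSet, w x ≠ ∞
  bound : ∀ Q : AxisCube n, Q.toSet ⊆ T.toSet →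
    (∫⁻ x in Q.toSet, w x) * (∫⁻ x in Q.toSet, w x ^ (-(1 / (q - 1)))) ^ (q - 1) ≤
      K * volume Q.toSet ^ q

theorem setLIntegral_ne_zero_of_pos (Q : AxisCube n) {w : (Fin n → ℝ) → ℝ≥0∞}
    (hw : Measurable w) (h0 : ∀ x, w x ≠ 0) : ∫⁻ x in Q.toSet, w x ≠ 0 := by
  rw [← pos_iff_ne_zero, setLIntegral_pos_iff hw, Function.support_eq_univ h0, Set.univ_inter]
  exact Q.volume_toSet_pos

namespace IsRegularWeight

variable {q : ℝ} {K : ℝ≥0} {T : AxisCube n} {w : (Fin n → ℝ) → ℝ≥0∞}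

theorem dual_measurable (hw : IsRegularWeight q K T w) :
    Measurable fun x => w x ^ (-(1 / (q - 1))) := hw.measurable.pow_const _

theorem dual_ne_zero (hw : IsRegularWeight q K T w) (x : Fin n → ℝ) :
    w x ^ (-(1 / (q - 1))) ≠ 0 := by
  simp [ENNReal.rpow_eq_zero_iff, hw.ne_zero x, hw.ne_top x]

theorem dual_ne_top (hw : IsRegularWeight q K T w) (x : Fin n → ℝ) :
    w x ^ (-(1 / (q - 1))) ≠ ∞ :=
  ENNReal.rpow_ne_top_of_ne_zero (hw.ne_zero x) (hw.ne_top x)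

theorem mass_ne_zero (hw : IsRegularWeight q K T w) (Q : AxisCube n) :
    ∫⁻ x in Q.toSet, w x ≠ 0 := setLIntegral_ne_zero_of_pos Q hw.measurable hw.ne_zero

theorem mass_ne_top (hw : IsRegularWeight q K T w) {Q : AxisCube n} (hQ : Q.toSet ⊆ T.toSet) :
    ∫⁻ x in Q.toSet, w x ≠ ∞ :=
  ne_top_of_le_ne_top hw.lintegral_ne_top (lintegral_mono_set hQ)

theorem dual_mass_ne_zero (hw : IsRegularWeight q K T w) (Q : AxisCube n) :
    ∫⁻ x in Q.toSet, w x ^ (-(1 / (q - 1))) ≠ 0 :=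
  setLIntegral_ne_zero_of_pos Q hw.dual_measurable hw.dual_ne_zero

theorem dual_mass_ne_top (hw : IsRegularWeight q K T w) {Q : AxisCube n}
    (hQ : Q.toSet ⊆ T.toSet) : ∫⁻ x in Q.toSet, w x ^ (-(1 / (q - 1))) ≠ ∞ := by
  intro h
  have hq := hw.one_lt
  have hb := hw.bound Q hQ
  rw [h, ENNReal.top_rpow_of_pos (by linarith), ENNReal.mul_top (hw.mass_ne_zero Q), top_le_iff]
    at hb
  exact ENNReal.mul_ne_top ENNReal.coe_ne_top
    (ENNReal.rpow_ne_top_of_nonneg (by linarith) Q.volume_toSet_ne_top) hb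

/-- Hölder's inequality for 1 = w^(1/q) w^(-1/q). It reverses the A_q bound up to the constant, and
the two together give doubling. -/
theorem volume_rpow_le (hw : IsRegularWeight q K T w) (Q : AxisCube n) :
    volume Q.toSet ^ q ≤
      (∫⁻ x in Q.toSet, w x) * (∫⁻ x in Q.toSet, w x ^ (-(1 / (q - 1)))) ^ (q - 1) := by
  have hq := hw.one_lt
  have hq0 : q ≠ 0 := by linarith
  have hq1 : q - 1 ≠ 0 := by linarith
  have hc : q.HolderConjugate (q / (q - 1)) := Real.HolderConjugate.conjExponent hq
  have h := ENNReal.lintegral_mul_le_Lp_mul_Lq (volume.restrict Q.toSet) hc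
    (hw.measurable.pow_const (1 / q)).aemeasurable
    (hw.measurable.pow_const (-(1 / q))).aemeasurable
  have e1 : ∀ x, ((fun x => w x ^ (1 / q)) * fun x => w x ^ (-(1 / q))) x = 1 := by
    intro x
    rw [Pi.mul_apply, ← ENNReal.rpow_add _ _ (hw.ne_zero x) (hw.ne_top x), add_neg_cancel,
      ENNReal.rpow_zero]
  have e2 : ∀ x, (w x ^ (1 / q)) ^ q = w x := by
    intro x; rw [← ENNReal.rpow_mul, one_div_mul_cancel hq0, ENNReal.rpow_one]
  have e3 : ∀ x, (w x ^ (-(1 / q))) ^ (q / (q - 1)) = w x ^ (-(1 / (q - 1))) := by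
    intro x; rw [← ENNReal.rpow_mul]; congr 1; field_simp
  simp only [e1, e2, e3, lintegral_one, Measure.restrict_apply_univ] at h
  refine (ENNReal.rpow_le_rpow h (by linarith : 0 ≤ q)).trans (le_of_eq ?_)
  rw [ENNReal.mul_rpow_of_nonneg _ _ (by linarith), ← ENNReal.rpow_mul, ← ENNReal.rpow_mul,
    one_div_mul_cancel hq0, ENNReal.rpow_one]
  congr 2
  field_simp

/-- The A_q bound on Q' and Hölder's inequality on Q are compared; the dual mass only grows from Q
to Q', so it cancels. -/
theorem mass_le_of_side_le (hw : IsRegularWeight q K T w) {Q Q' : AxisCube n}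
    (hQ : Q.toSet ⊆ Q'.toSet) (hQ' : Q'.toSet ⊆ T.toSet) {a : ℝ} (ha : 0 ≤ a)
    (h : Q'.side ≤ a * Q.side) :
    ∫⁻ x in Q'.toSet, w x ≤
      K * ENNReal.ofReal (a ^ n) ^ q * ∫⁻ x in Q.toSet, w x := by
  have hq := hw.one_lt
  have hq1 : 0 < q - 1 := by linarith
  set S := (∫⁻ x in Q.toSet, w x ^ (-(1 / (q - 1)))) ^ (q - 1) with hS
  have hS0 : S ≠ 0 := (ENNReal.rpow_pos (pos_iff_ne_zero.2 (hw.dual_mass_ne_zero Q))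
    (hw.dual_mass_ne_top (hQ.trans hQ'))).ne'
  have hS1 : S ≠ ∞ := ENNReal.rpow_ne_top_of_nonneg hq1.le (hw.dual_mass_ne_top (hQ.trans hQ'))
  rw [← ENNReal.mul_le_mul_iff_left hS0 hS1]
  calc (∫⁻ x in Q'.toSet, w x) * S
      ≤ (∫⁻ x in Q'.toSet, w x) * (∫⁻ x in Q'.toSet, w x ^ (-(1 / (q - 1)))) ^ (q - 1) := by
        rw [hS]; gcongr
    _ ≤ K * volume Q'.toSet ^ q := hw.bound Q' hQ'
    _ ≤ K * (ENNReal.ofReal (a ^ n) * volume Q.toSet) ^ q := by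
        gcongr
        exact volume_toSet_le_mul ha h
    _ = K * ENNReal.ofReal (a ^ n) ^ q * volume Q.toSet ^ q := by
        rw [ENNReal.mul_rpow_of_nonneg _ _ (by linarith), mul_assoc]
    _ ≤ K * ENNReal.ofReal (a ^ n) ^ q * ((∫⁻ x in Q.toSet, w x) * S) := by
        gcongr
        exact hw.volume_rpow_le Q
    _ = _ := by ring

/-- The same comparison with the two masses exchanged; undoing the power q - 1 puts the exponent
1/(q - 1) on the constant. -/
theorem dual_mass_le_of_side_le (hw : IsRegularWeight q K T w) {Q Q' : AxisCube n}
    (hQ : Q.toSet ⊆ Q'.toSet) (hQ' : Q'.toSet ⊆ T.toSet) {a : ℝ} (ha : 0 ≤ a)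
    (h : Q'.side ≤ a * Q.side) :
    ∫⁻ x in Q'.toSet, w x ^ (-(1 / (q - 1))) ≤
      (K * ENNReal.ofReal (a ^ n) ^ q) ^ (1 / (q - 1)) *
        ∫⁻ x in Q.toSet, w x ^ (-(1 / (q - 1))) := by
  have hq := hw.one_lt
  have hq1 : 0 < q - 1 := by linarith
  rw [← ENNReal.rpow_le_rpow_iff hq1, ENNReal.mul_rpow_of_nonneg _ _ hq1.le,
    ← ENNReal.rpow_mul _ (1 / (q - 1)), one_div_mul_cancel hq1.ne', ENNReal.rpow_one,
    ← ENNReal.mul_le_mul_iff_right (hw.mass_ne_zero Q) (hw.mass_ne_top (hQ.trans hQ'))]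
  calc (∫⁻ x in Q.toSet, w x) * (∫⁻ x in Q'.toSet, w x ^ (-(1 / (q - 1)))) ^ (q - 1)
      ≤ (∫⁻ x in Q'.toSet, w x) * (∫⁻ x in Q'.toSet, w x ^ (-(1 / (q - 1)))) ^ (q - 1) := by
        gcongr
    _ ≤ K * volume Q'.toSet ^ q := hw.bound Q' hQ'
    _ ≤ K * (ENNReal.ofReal (a ^ n) * volume Q.toSet) ^ q := by
        gcongr
        exact volume_toSet_le_mul ha h
    _ = K * ENNReal.ofReal (a ^ n) ^ q * volume Q.toSet ^ q := by
        rw [ENNReal.mul_rpow_of_nonneg _ _ (by linarith), mul_assoc]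
    _ ≤ K * ENNReal.ofReal (a ^ n) ^ q * ((∫⁻ x in Q.toSet, w x) *
          (∫⁻ x in Q.toSet, w x ^ (-(1 / (q - 1)))) ^ (q - 1)) := by
        gcongr
        exact hw.volume_rpow_le Q
    _ = _ := by ring

end IsRegularWeight

/-- The noncentred maximal function of `f` over the interiors of subcubes of `T`, where averages
are normalised by the measure `μ`. -/
noncomputable def interiorMaximal (T : AxisCube n) (μ : Measure (Fin n → ℝ))
    (f : (Fin n → ℝ) → ℝ≥0∞) (x : Fin n → ℝ) : ℝ≥0∞ :=
  ⨆ (Q : AxisCube n) (_ : Q.toSet ⊆ T.toSet) (_ : x ∈ Metric.ball Q.center (Q.side / 2)),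
    (∫⁻ y in Q.toSet, f y) / μ Q.toSet

theorem lt_interiorMaximal_iff {T : AxisCube n} {μ : Measure (Fin n → ℝ)}
    {f : (Fin n → ℝ) → ℝ≥0∞} {x : Fin n → ℝ} {t : ℝ≥0∞} :
    t < interiorMaximal T μ f x ↔ ∃ Q : AxisCube n, Q.toSet ⊆ T.toSet ∧
      x ∈ Metric.ball Q.center (Q.side / 2) ∧ t < (∫⁻ y in Q.toSet, f y) / μ Q.toSet := by
  simp only [interiorMaximal, lt_iSup_iff, exists_prop]

theorem measurable_interiorMaximal (T : AxisCube n) (μ : Measure (Fin n → ℝ))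
    (f : (Fin n → ℝ) → ℝ≥0∞) : Measurable (interiorMaximal T μ f) := by
  refine measurable_of_Ioi fun t => IsOpen.measurableSet ?_
  have : interiorMaximal T μ f ⁻¹' Set.Ioi t = ⋃ (Q : AxisCube n) (_ : Q.toSet ⊆ T.toSet ∧
      t < (∫⁻ y in Q.toSet, f y) / μ Q.toSet), Metric.ball Q.center (Q.side / 2) := by
    ext x
    simp only [Set.mem_preimage, Set.mem_Ioi, lt_interiorMaximal_iff, Set.mem_iUnion, exists_prop]
    exact exists_congr fun Q => by tauto
  rw [this]
  exact isOpen_iUnion fun Q => isOpen_iUnion fun _ => Metric.isOpen_ball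

/-- The constant in the weighted maximal inequality. -/
noncomputable def weightedMaximalConst (n : ℕ) (q : ℝ) (K : ℝ≥0) : ℝ≥0∞ :=
  strongTypeConst (K * ENNReal.ofReal (5 ^ n) ^ q) (q / (q - 1)) * (K : ℝ≥0∞) ^ (q / (q - 1)) *
    strongTypeConst ((K * ENNReal.ofReal (5 ^ n) ^ q) ^ (1 / (q - 1))) q

theorem weightedMaximalConst_ne_top (n : ℕ) {q : ℝ} (hq : 1 < q) (K : ℝ≥0) :
    weightedMaximalConst n q K ≠ ∞ := by
  have h1 : (K : ℝ≥0∞) * ENNReal.ofReal (5 ^ n) ^ q ≠ ∞ :=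
    ENNReal.mul_ne_top ENNReal.coe_ne_top
      (ENNReal.rpow_ne_top_of_nonneg (by linarith) ENNReal.ofReal_ne_top)
  have h2 : 0 < q - 1 := by linarith
  have h3 : 1 < q / (q - 1) := by rw [lt_div_iff₀ h2]; linarith
  refine ENNReal.mul_ne_top (ENNReal.mul_ne_top (strongTypeConst_ne_top h1 h3) ?_)
    (strongTypeConst_ne_top (ENNReal.rpow_ne_top_of_nonneg (by positivity) h1) hq)
  exact ENNReal.rpow_ne_top_of_nonneg (by positivity) ENNReal.coe_ne_top

/-- Muckenhoupt's theorem: the noncentred maximal operator over the subcubes of `T` is bounded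
on `L^q(w)` for an `A_q` weight `w`. -/
theorem IsRegularWeight.lintegral_rpow_mul_le (hn : n ≠ 0) {q : ℝ} {K : ℝ≥0} {T : AxisCube n}
    {w : (Fin n → ℝ) → ℝ≥0∞} (hw : IsRegularWeight q K T w)
    {h f : (Fin n → ℝ) → ℝ≥0∞} (hh : Measurable h) (hf : Measurable f)
    (hfh : ∀ x, ∀ t : ℝ≥0, t < h x → ∃ Q : AxisCube n, x ∈ Q.toSet ∧ Q.toSet ⊆ T.toSet ∧
      t * volume Q.toSet ≤ ∫⁻ y in Q.toSet, f y) :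
    ∫⁻ x, h x ^ q * w x ≤ weightedMaximalConst n q K * ∫⁻ x in T.toSet, f x ^ q * w x := by
  have hq := hw.one_lt
  have hq0 : 0 < q := by linarith
  have hq1 : 0 < q - 1 := by linarith
  have hr : 1 < q / (q - 1) := by rw [lt_div_iff₀ hq1]; linarith
  -- Write σ for the measure s dx and H for the maximal function of f with averages normalised by σ.
  -- The A_q bound gives (⨍_Q f)^(q-1) ≤ K (|Q| / w(Q)) (∫_Q f / σ(Q))^(q-1) ≤ (K / w(Q)) ∫_Q
  -- H^(q-1). Hence h^(q-1) is dominated by the w-maximal function of K H^(q-1) / w, to which the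
  -- strong type bound in L^(q/(q-1))(w) applies, and H in turn is bounded in L^q(σ).
  set s : (Fin n → ℝ) → ℝ≥0∞ := fun x => w x ^ (-(1 / (q - 1))) with hs
  have hsm : Measurable s := hw.dual_measurable
  have hfs : Measurable fun x => f x * (s x)⁻¹ := hf.mul hsm.inv
  set μs := volume.withDensity s with hμs
  set μw := volume.withDensity w with hμw
  have massw : ∀ Q : AxisCube n, μw Q.toSet = ∫⁻ x in Q.toSet, w x := fun Q =>
    withDensity_apply _ Q.measurableSet_toSet
  have masss : ∀ Q : AxisCube n, μs Q.toSet = ∫⁻ x in Q.toSet, s x := fun Q =>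
    withDensity_apply _ Q.measurableSet_toSet
  set H := interiorMaximal T μs f with hH
  have hHm : Measurable H := measurable_interiorMaximal T μs f
  -- the maximal operator with respect to the dual weight
  have inner : ∫⁻ x, H x ^ q * s x ≤
      strongTypeConst ((K * ENNReal.ofReal (5 ^ n) ^ q) ^ (1 / (q - 1))) q *
        ∫⁻ x in T.toSet, f x ^ q * w x := by
    have := lintegral_rpow_le_of_le_maximal hn T μs
      (fun Q hQ => by rw [masss]; exact hw.dual_mass_ne_top hQ)
      (D := (K * ENNReal.ofReal (5 ^ n) ^ q) ^ (1 / (q - 1)))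
      (fun Q Q' h1 h2 h3 => by
        rw [masss, masss]; exact hw.dual_mass_le_of_side_le h1 h2 (by norm_num) h3)
      (h := H) (g := fun x => f x * (s x)⁻¹) hHm hfs
      (fun x t ht => by
        obtain ⟨Q, hQT, hxQ, hQ⟩ := lt_interiorMaximal_iff.1 ht
        refine ⟨Q, ?_, hQT, ?_⟩
        · rw [toSet_eq_closedBall]; exact Metric.ball_subset_closedBall hxQ
        · rw [hμs, setLIntegral_withDensity_eq_setLIntegral_mul _ hsm hfs
            Q.measurableSet_toSet]
          refine (ENNReal.mul_le_of_le_div hQ.le).trans (le_of_eq (lintegral_congr fun y => ?_))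
          rw [Pi.mul_apply, mul_left_comm,
            ENNReal.mul_inv_cancel (hw.dual_ne_zero y) (hw.dual_ne_top y), mul_one]) hq
    rw [hμs, lintegral_withDensity_eq_lintegral_mul _ hsm (hHm.pow_const _),
      setLIntegral_withDensity_eq_setLIntegral_mul _ hsm (hfs.pow_const _)
        T.measurableSet_toSet] at this
    have eL : ∫⁻ x, H x ^ q * s x = ∫⁻ x, (s * fun x => H x ^ q) x :=
      lintegral_congr fun x => by rw [Pi.mul_apply, mul_comm]
    have eR : ∫⁻ x in T.toSet, f x ^ q * w x =
        ∫⁻ x in T.toSet, (s * fun x => (f x * (s x)⁻¹) ^ q) x := by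
      refine lintegral_congr fun x => ?_
      rw [Pi.mul_apply, ENNReal.mul_rpow_of_nonneg _ _ hq0.le, mul_left_comm, hs]
      congr 1
      rw [← ENNReal.rpow_neg, neg_neg, ← ENNReal.rpow_mul,
        ← ENNReal.rpow_add _ _ (hw.ne_zero x) (hw.ne_top x)]
      conv_lhs => rw [← ENNReal.rpow_one (w x)]
      congr 1
      field_simp
      ring
    rw [eL, eR]
    exact this
  -- the maximal operator with respect to the weight
  have hGm : Measurable fun x => K * H x ^ (q - 1) * (w x)⁻¹ :=
    ((hHm.pow_const _).const_mul _).mul hw.measurable.inv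
  have outer := lintegral_rpow_le_of_le_maximal hn T μw
      (fun Q hQ => by rw [massw]; exact hw.mass_ne_top hQ)
      (D := K * ENNReal.ofReal (5 ^ n) ^ q)
      (fun Q Q' h1 h2 h3 => by
        rw [massw, massw]; exact hw.mass_le_of_side_le h1 h2 (by norm_num) h3)
      (h := fun x => h x ^ (q - 1)) (g := fun x => K * H x ^ (q - 1) * (w x)⁻¹)
      (hh.pow_const _) hGm
      (fun x t ht => by
        have ht' : ((t ^ (1 / (q - 1)) : ℝ≥0) : ℝ≥0∞) < h x := by
          rw [ENNReal.coe_rpow_of_nonneg _ (by positivity), ← ENNReal.rpow_lt_rpow_iff hq1, ← ENNReal.rpow_mul, one_div_mul_cancel hq1.ne',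
            ENNReal.rpow_one]
          exact ht
        obtain ⟨Q, hxQ, hQT, hQ⟩ := hfh x _ ht'
        refine ⟨Q, hxQ, hQT, ?_⟩
        rw [hμw, setLIntegral_withDensity_eq_setLIntegral_mul _ hw.measurable hGm
            Q.measurableSet_toSet, ← hμw, massw]
        set S := ∫⁻ x in Q.toSet, s x with hS
        have hS0 : S ≠ 0 := hw.dual_mass_ne_zero Q
        have hS1 : S ≠ ∞ := hw.dual_mass_ne_top hQT
        have hSq0 : S ^ (q - 1) ≠ 0 := (ENNReal.rpow_pos (pos_iff_ne_zero.2 hS0) hS1).ne'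
        have hSq1 : S ^ (q - 1) ≠ ∞ := ENNReal.rpow_ne_top_of_nonneg hq1.le hS1
        have hlow : t * volume Q.toSet ^ (q - 1) / S ^ (q - 1) * volume Q.toSet ≤
            ∫⁻ y in Q.toSet, H y ^ (q - 1) := by
          rw [← setLIntegral_const]
          refine lintegral_mono_ae ?_
          -- H is a supremum over open cubes, so the lower bound holds off the null boundary of Q.
          have hball : ∀ᵐ y ∂volume.restrict Q.toSet,
              y ∈ Metric.ball Q.center (Q.side / 2) := by
            rw [← Measure.restrict_congr_set (ball_ae_eq_toSet hn Q)]
            exact ae_restrict_mem Metric.isOpen_ball.measurableSet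
          filter_upwards [hball] with y hy
          have hHy : (∫⁻ y in Q.toSet, f y) / S ≤ H y := by
            rw [hS, ← masss Q]
            exact le_iSup_of_le Q (le_iSup₂_of_le hQT hy le_rfl)
          refine le_trans ?_ (ENNReal.rpow_le_rpow hHy hq1.le)
          refine le_trans ?_ (ENNReal.rpow_le_rpow (ENNReal.div_le_div_right hQ S) hq1.le)
          rw [ENNReal.div_rpow_of_nonneg _ _ hq1.le, ENNReal.mul_rpow_of_nonneg _ _ hq1.le,
            ← ENNReal.coe_rpow_of_nonneg _ hq1.le, ← NNReal.rpow_mul,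
            one_div_mul_cancel hq1.ne', NNReal.rpow_one]
        have hvol : volume Q.toSet ^ q = volume Q.toSet ^ (q - 1) * volume Q.toSet := by
          conv_rhs => rw [← ENNReal.rpow_one (volume Q.toSet), ← ENNReal.rpow_mul, one_mul]
          rw [← ENNReal.rpow_add_of_nonneg _ _ hq1.le zero_le_one, sub_add_cancel]
        have hb : ∫⁻ x in Q.toSet, w x ≤ K * volume Q.toSet ^ q / S ^ (q - 1) := by
          rw [ENNReal.le_div_iff_mul_le (Or.inl hSq0) (Or.inl hSq1)]
          exact hw.bound Q hQT
        calc t * ∫⁻ x in Q.toSet, w x ≤ t * (K * volume Q.toSet ^ q / S ^ (q - 1)) := by gcongr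
          _ = K * (t * volume Q.toSet ^ (q - 1) / S ^ (q - 1) * volume Q.toSet) := by
              rw [hvol]; simp only [div_eq_mul_inv]; ring
          _ ≤ K * ∫⁻ y in Q.toSet, H y ^ (q - 1) := by gcongr
          _ = _ := by
              rw [← lintegral_const_mul _ (hHm.pow_const _)]
              refine lintegral_congr fun y => ?_
              rw [Pi.mul_apply, mul_left_comm, ENNReal.mul_inv_cancel (hw.ne_zero y) (hw.ne_top y),
                mul_one]) hr
  rw [hμw, lintegral_withDensity_eq_lintegral_mul _ hw.measurable
      ((hh.pow_const _).pow_const _),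
    setLIntegral_withDensity_eq_setLIntegral_mul _ hw.measurable (hGm.pow_const _)
      T.measurableSet_toSet] at outer
  have eL : ∫⁻ x, h x ^ q * w x =
      ∫⁻ x, (w * fun x => (h x ^ (q - 1)) ^ (q / (q - 1))) x := by
    refine lintegral_congr fun x => ?_
    rw [Pi.mul_apply, mul_comm, ← ENNReal.rpow_mul, mul_div_cancel₀ _ hq1.ne']
  have eR : ∫⁻ x in T.toSet, (w * fun x => (K * H x ^ (q - 1) * (w x)⁻¹) ^ (q / (q - 1))) x =
      (K : ℝ≥0∞) ^ (q / (q - 1)) * ∫⁻ x in T.toSet, H x ^ q * s x := by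
    have hHs : Measurable fun x => H x ^ q * s x := (hHm.pow_const _).mul hsm
    rw [← lintegral_const_mul _ hHs]
    refine lintegral_congr fun x => ?_
    have hr0 : 0 ≤ q / (q - 1) := by positivity
    rw [Pi.mul_apply, ENNReal.mul_rpow_of_nonneg _ _ hr0, ENNReal.mul_rpow_of_nonneg _ _ hr0,
      ← ENNReal.rpow_mul, mul_div_cancel₀ _ hq1.ne', mul_left_comm, mul_assoc]
    congr 2
    rw [← ENNReal.rpow_neg_one, ← ENNReal.rpow_mul, hs]
    conv_lhs => enter [1]; rw [← ENNReal.rpow_one (w x)]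
    rw [← ENNReal.rpow_add _ _ (hw.ne_zero x) (hw.ne_top x)]
    congr 1
    field_simp
    ring
  rw [eL]
  refine outer.trans ?_
  rw [eR, weightedMaximalConst, mul_assoc, mul_assoc]
  gcongr
  exact (setLIntegral_le_lintegral _ _).trans inner

/-! ### The local estimate on one cube. -/

theorem lt_supAverage_iff {Q : AxisCube n} {S : Set (Fin n → ℝ)} {f : (Fin n → ℝ) → ℝ}
    {t : ℝ≥0∞} : t < Q.supAverage S f ↔ ∃ Q' : AxisCube n, Q.toSet ⊆ Q'.toSet ∧ Q'.toSet ⊆ S ∧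
      t * volume Q'.toSet < ∫⁻ x in Q'.toSet, ‖f x‖ₑ := by
  simp only [supAverage, lt_iSup_iff, exists_prop, setLAverage_eq,
    ENNReal.lt_div_iff_mul_lt (Or.inl (volume_toSet_ne_zero _))
      (Or.inl (volume_toSet_ne_top _))]

theorem lintegral_le_supAverage_mul {Q Q' : AxisCube n} {S : Set (Fin n → ℝ)}
    (f : (Fin n → ℝ) → ℝ) (h : Q.toSet ⊆ Q'.toSet) (h' : Q'.toSet ⊆ S) :
    ∫⁻ x in Q'.toSet, ‖f x‖ₑ ≤ Q.supAverage S f * volume Q'.toSet := by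
  rw [← ENNReal.div_le_iff (volume_toSet_ne_zero _) (volume_toSet_ne_top _), ← setLAverage_eq]
  exact le_iSup_of_le Q' (le_iSup₂_of_le h h' le_rfl)

/-- The integral over a cube that meets `P` is controlled by the averages over the cubes
containing `P`. -/
theorem lintegral_le_supAverage_mul_of_mem {P Q T : AxisCube n} (f : (Fin n → ℝ) → ℝ)
    (hP : P.toSet ⊆ T.toSet) (hQ : Q.toSet ⊆ T.toSet) {x : Fin n → ℝ} (hxP : x ∈ P.toSet)
    (hxQ : x ∈ Q.toSet) {a : ℝ} (ha : 0 ≤ a) (h : Q.side + 2 * P.side ≤ a * Q.side) :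
    ∫⁻ y in Q.toSet, ‖f y‖ₑ ≤
      P.supAverage T.toSet f * (ENNReal.ofReal (a ^ n) * volume Q.toSet) := by
  have hP0 := P.side_pos
  have hQ0 := Q.side_pos
  -- Since P and Q meet, the ball about the centre of Q of radius Q.side / 2 + P.side contains P.
  obtain ⟨R, h1, h2, h3⟩ := T.exists_cube_of_closedBall_inter Q.center
    (ρ := (Q.side + 2 * P.side) / 2) (by linarith)
  have hQR : Q.toSet ⊆ R.toSet := by
    refine Set.Subset.trans (Set.subset_inter ?_ hQ) h3
    rw [toSet_eq_closedBall]
    exact Metric.closedBall_subset_closedBall (by linarith)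
  have hPR : P.toSet ⊆ R.toSet := by
    refine Set.Subset.trans (Set.subset_inter (fun y hy => ?_) hP) h3
    rw [toSet_eq_closedBall, Metric.mem_closedBall] at hxP hxQ hy
    rw [Metric.mem_closedBall]
    linarith [dist_triangle y P.center Q.center, dist_triangle P.center x Q.center,
      dist_comm x P.center]
  calc ∫⁻ y in Q.toSet, ‖f y‖ₑ ≤ ∫⁻ y in R.toSet, ‖f y‖ₑ := lintegral_mono_set hQR
    _ ≤ P.supAverage T.toSet f * volume R.toSet := lintegral_le_supAverage_mul f hPR h2
    _ ≤ _ := by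
        gcongr
        exact volume_toSet_le_mul ha (by linarith)

/-- Jensen's inequality with denominators cleared, from Hölder's inequality against the constant 1.
-/
theorem rpow_setLIntegral_le (Q : AxisCube n) {p : ℝ} (hp : 1 < p) {g : (Fin n → ℝ) → ℝ≥0∞}
    (hg : AEMeasurable g (volume.restrict Q.toSet)) :
    (∫⁻ x in Q.toSet, g x) ^ p ≤ volume Q.toSet ^ (p - 1) * ∫⁻ x in Q.toSet, g x ^ p := by
  have hp0 : 0 < p := by linarith
  have h := ENNReal.lintegral_mul_le_Lp_mul_Lq (volume.restrict Q.toSet)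
    (Real.HolderConjugate.conjExponent hp) hg (aemeasurable_const (b := 1))
  simp only [Pi.mul_apply, mul_one, ENNReal.one_rpow, lintegral_one,
    Measure.restrict_apply_univ] at h
  refine (ENNReal.rpow_le_rpow h hp0.le).trans (le_of_eq ?_)
  have hp1 : p - 1 ≠ 0 := by linarith
  rw [ENNReal.mul_rpow_of_nonneg _ _ hp0.le, ← ENNReal.rpow_mul, ← ENNReal.rpow_mul,
    one_div_mul_cancel hp0.ne', ENNReal.rpow_one, mul_comm]
  congr 2
  rw [Real.conjExponent]
  field_simp

/-- The weak type `(1,1)` estimate on a cube, for Lebesgue measure. -/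
theorem mul_volume_le_of_covered (hn : n ≠ 0) (T : AxisCube n)
    {E : Set (Fin n → ℝ)} {t : ℝ≥0∞} {g : (Fin n → ℝ) → ℝ≥0∞}
    (hE : ∀ x ∈ E, ∃ Q : AxisCube n, x ∈ Q.toSet ∧ Q.toSet ⊆ T.toSet ∧
      t * volume Q.toSet ≤ ∫⁻ y in Q.toSet, g y) :
    t * volume E ≤ 5 ^ n * ∫⁻ y in T.toSet, g y := by
  refine T.mul_measure_le_of_covered hn volume (fun Q Q' _ _ h => ?_) hE
  refine (volume_toSet_le_mul (by norm_num) h).trans (le_of_eq ?_)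
  rw [ENNReal.ofReal_pow (by norm_num), ENNReal.ofReal_ofNat]

/-- The local estimate behind the good-`λ` inequality: in a cube `Q` whose parent `P` has small
averages, the set where some average of `F` exceeds `A * l` is a small portion of `Q`. -/
theorem volume_le_of_local_decomposition (hn : n ≠ 0) {p α : ℝ} (hp : 1 < p) (hα : 1 < α)
    {Q P T : AxisCube n} (hQP : Q.toSet ⊆ P.toSet) (hPT : P.toSet ⊆ T.toSet)
    (hside : P.side = 2 * Q.side) (hαQ : Q.dilate α ⊆ T.toSet)
    {F f G R : (Fin n → ℝ) → ℝ} {C₁ C₂ A l γ : ℝ≥0} (hA : 9 ^ n ≤ A) (hl : 0 < l) (hγ : γ ≤ 1)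
    (hFP : P.supAverage T.toSet F ≤ l) (hfQ : Q.supAverage T.toSet f ≤ γ * l)
    (hG : IntegrableOn G (Q.dilate 2)) (hR : IntegrableOn R (Q.dilate 2))
    (hFGR : ∀ᵐ x ∂(volume.restrict (Q.dilate 2)), |F x| ≤ |G x| + |R x|)
    (hRp : (⨍⁻ x in Q.dilate 2, ‖R x‖ₑ ^ p ∂volume) ^ (1 / p) ≤
      C₁ * ((⨍⁻ x in Q.dilate α, ‖F x‖ₑ ∂volume) + Q.supAverage T.toSet f))
    (hG1 : (⨍⁻ x in Q.dilate 2, ‖G x‖ₑ ∂volume) ≤ C₂ * Q.supAverage T.toSet f)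
    {E : Set (Fin n → ℝ)}
    (hE : ∀ x ∈ E, x ∈ Q.toSet ∧ ∃ Q' : AxisCube n, x ∈ Q'.toSet ∧ Q'.toSet ⊆ T.toSet ∧
      A * l * volume Q'.toSet < ∫⁻ y in Q'.toSet, ‖F y‖ₑ) :
    volume E ≤ (10 ^ n * (2 * C₂ * γ / A + (2 * C₁ * (5 ^ n + 1) / A) ^ p) : ℝ≥0) *
      volume Q.toSet := by
  have hp0 : 0 < p := by linarith
  have hQ0 := Q.side_pos
  have hA0 : 0 < A := lt_of_lt_of_le (by positivity) hA
  set Q2 := Q.scale 2 (by norm_num) with hQ2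
  have hQ2s : Q.dilate 2 = Q2.toSet := rfl
  set Qa := Q.scale α (by linarith) with hQa
  have hQas : Q.dilate α = Qa.toSet := rfl
  rw [hQ2s] at hG hR hFGR hRp hG1
  rw [hQas] at hRp hαQ
  have hvol2 : volume Q2.toSet = 2 ^ n * volume Q.toSet := by
    rw [volume_toSet, volume_toSet, show Q2.side = 2 * Q.side from rfl, mul_pow,
      ENNReal.ofReal_mul (by positivity), ENNReal.ofReal_pow (by norm_num), ENNReal.ofReal_ofNat]
  have hQc : Q.center ∈ Q.toSet := by
    rw [toSet_eq_closedBall]; exact Metric.mem_closedBall_self (by linarith)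
  -- the exceptional averages are taken over subcubes of `2Q`
  have small : ∀ x ∈ E, ∃ Q' : AxisCube n, x ∈ Q'.toSet ∧ Q'.toSet ⊆ Q2.toSet ∧
      A * l * volume Q'.toSet < ∫⁻ y in Q'.toSet, ‖F y‖ₑ := by
    intro x hx
    obtain ⟨hxQ, Q', hxQ', hQ'T, hQ'⟩ := hE x hx
    refine ⟨Q', hxQ', ?_, hQ'⟩
    have hQ'0 := Q'.side_pos
    -- Otherwise P.side = 2 * Q.side < 4 * Q'.side, and a cube of side at most 9 * Q'.side contains
    -- both Q' and P. The averages over such cubes are at most l, so that over Q' is at most 9ⁿ l ≤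
    -- A l.
    have hle : Q'.side ≤ Q.side / 2 := by
      by_contra! hlt
      refine hQ'.not_ge ?_
      refine (lintegral_le_supAverage_mul_of_mem (P := P) F hPT hQ'T (hQP hxQ) hxQ'
        (a := 9) (by norm_num) (by linarith)).trans ?_
      rw [ENNReal.ofReal_pow (by norm_num), ENNReal.ofReal_ofNat, ← mul_assoc]
      refine mul_le_mul_left ?_ _
      rw [mul_comm]
      exact mul_le_mul' (by exact_mod_cast hA) hFP
    intro y hy
    rw [toSet_eq_closedBall, Metric.mem_closedBall] at *
    rw [show Q2.center = Q.center from rfl, show Q2.side = 2 * Q.side from rfl]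
    linarith [dist_triangle y Q'.center Q.center, dist_triangle Q'.center x Q.center,
      dist_comm x Q'.center]
  have hu0 : ((A * l / 2 : ℝ≥0) : ℝ≥0∞) ≠ 0 := by
    have : A * l / 2 ≠ 0 := by positivity
    exact_mod_cast this
  have hup0 : (((A * l / 2) ^ p : ℝ≥0) : ℝ≥0∞) ≠ 0 := by
    have : (A * l / 2) ^ p ≠ 0 := (NNReal.rpow_pos (by positivity)).ne'
    exact_mod_cast this
  set E₁ : Set (Fin n → ℝ) := {x | ∃ Q' : AxisCube n, x ∈ Q'.toSet ∧ Q'.toSet ⊆ Q2.toSet ∧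
      ((A * l / 2 : ℝ≥0) : ℝ≥0∞) * volume Q'.toSet ≤ ∫⁻ y in Q'.toSet, ‖G y‖ₑ} with hE₁
  set E₂ : Set (Fin n → ℝ) := {x | ∃ Q' : AxisCube n, x ∈ Q'.toSet ∧ Q'.toSet ⊆ Q2.toSet ∧
      (((A * l / 2) ^ p : ℝ≥0) : ℝ≥0∞) * volume Q'.toSet ≤
        ∫⁻ y in Q'.toSet, ‖R y‖ₑ ^ p} with hE₂
  -- If |F| averages more than A l over Q', then |G| or |R| averages at least A l / 2. For R, Jensen
  -- passes to |R|^p, whose integral over 2Q is controlled.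
  have hsub : E ⊆ E₁ ∪ E₂ := by
    intro x hx
    obtain ⟨Q', hxQ', hQ'2, hQ'⟩ := small x hx
    have hmG : AEMeasurable (fun y => ‖G y‖ₑ) (volume.restrict Q'.toSet) :=
      (hG.mono_set hQ'2).aestronglyMeasurable.enorm
    have hmR : AEMeasurable (fun y => ‖R y‖ₑ) (volume.restrict Q'.toSet) :=
      (hR.mono_set hQ'2).aestronglyMeasurable.enorm
    have hsum : ∫⁻ y in Q'.toSet, ‖F y‖ₑ ≤
        (∫⁻ y in Q'.toSet, ‖G y‖ₑ) + ∫⁻ y in Q'.toSet, ‖R y‖ₑ := by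
      rw [← lintegral_add_left' hmG]
      refine lintegral_mono_ae ?_
      filter_upwards [ae_restrict_of_ae_restrict_of_subset hQ'2 hFGR] with y hy
      rw [Real.enorm_eq_ofReal_abs, Real.enorm_eq_ofReal_abs, Real.enorm_eq_ofReal_abs,
        ← ENNReal.ofReal_add (abs_nonneg _) (abs_nonneg _)]
      exact ENNReal.ofReal_le_ofReal hy
    by_cases hcase : ((A * l / 2 : ℝ≥0) : ℝ≥0∞) * volume Q'.toSet ≤ ∫⁻ y in Q'.toSet, ‖G y‖ₑ
    · exact Or.inl ⟨Q', hxQ', hQ'2, hcase⟩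
    · refine Or.inr ⟨Q', hxQ', hQ'2, ?_⟩
      have hRlow : ((A * l / 2 : ℝ≥0) : ℝ≥0∞) * volume Q'.toSet ≤
          ∫⁻ y in Q'.toSet, ‖R y‖ₑ := by
        by_contra hcase'
        refine hQ'.not_ge (hsum.trans ((add_le_add (not_le.1 hcase).le
          (not_le.1 hcase').le).trans (le_of_eq ?_)))
        rw [← add_mul, ← ENNReal.coe_add, add_halves, ENNReal.coe_mul]
      have hv0 : volume Q'.toSet ^ (p - 1) ≠ 0 :=
        (ENNReal.rpow_pos Q'.volume_toSet_pos Q'.volume_toSet_ne_top).ne'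
      have hv1 : volume Q'.toSet ^ (p - 1) ≠ ∞ :=
        ENNReal.rpow_ne_top_of_nonneg (by linarith) Q'.volume_toSet_ne_top
      rw [← ENNReal.mul_le_mul_iff_right hv0 hv1]
      refine le_trans (le_of_eq ?_) ((ENNReal.rpow_le_rpow hRlow hp0.le).trans
        (Q'.rpow_setLIntegral_le hp hmR))
      rw [ENNReal.mul_rpow_of_nonneg _ _ hp0.le, mul_left_comm, ENNReal.coe_rpow_of_nonneg _ hp0.le]
      congr 1
      conv_rhs => rw [show p = p - 1 + 1 by ring,
        ENNReal.rpow_add_of_nonneg _ _ (by linarith) zero_le_one, ENNReal.rpow_one]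
  have hG2 : ∫⁻ y in Q2.toSet, ‖G y‖ₑ ≤ C₂ * (γ * l) * volume Q2.toSet := by
    rw [setLAverage_eq, ENNReal.div_le_iff (volume_toSet_ne_zero _) (volume_toSet_ne_top _)] at hG1
    exact hG1.trans (by gcongr)
  -- Here P.side = 2 * Q.side and α > 1, so α Q.side + 2 P.side ≤ 5 α Q.side, whence 5ⁿ.
  have hFα : (⨍⁻ x in Qa.toSet, ‖F x‖ₑ ∂volume) ≤ 5 ^ n * l := by
    rw [setLAverage_eq, ENNReal.div_le_iff (volume_toSet_ne_zero _) (volume_toSet_ne_top _)]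
    refine (lintegral_le_supAverage_mul_of_mem (P := P) F hPT hαQ (hQP hQc) (x := Q.center) ?_
      (a := 5) (by norm_num) ?_).trans ?_
    · rw [toSet_eq_closedBall]
      exact Metric.mem_closedBall_self (by linarith [Qa.side_pos])
    · rw [show Qa.side = α * Q.side from rfl, hside]; nlinarith
    · rw [ENNReal.ofReal_pow (by norm_num), ENNReal.ofReal_ofNat, ← mul_assoc, mul_comm (5 ^ n)]
      gcongr
  have hR2 : ∫⁻ y in Q2.toSet, ‖R y‖ₑ ^ p ≤
      ((C₁ * ((5 ^ n + 1) * l)) ^ p : ℝ≥0) * volume Q2.toSet := by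
    rw [← ENNReal.div_le_iff (volume_toSet_ne_zero _) (volume_toSet_ne_top _), ← setLAverage_eq]
    rw [one_div, ENNReal.rpow_inv_le_iff hp0] at hRp
    refine hRp.trans ?_
    rw [ENNReal.coe_rpow_of_nonneg _ hp0.le]
    refine ENNReal.rpow_le_rpow ?_ hp0.le
    push_cast
    gcongr
    rw [add_mul, one_mul]
    refine add_le_add hFα (hfQ.trans ?_)
    exact_mod_cast mul_le_of_le_one_left zero_le hγ
  -- In 10ⁿ the factor 5ⁿ is the weak type constant and 2ⁿ is |2Q| / |Q|.
  have vol1 : volume E₁ ≤ ((10 ^ n * (2 * C₂ * γ / A) : ℝ≥0) : ℝ≥0∞) * volume Q.toSet := by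
    rw [← ENNReal.mul_le_mul_iff_right hu0 ENNReal.coe_ne_top]
    refine (Q2.mul_volume_le_of_covered hn (E := E₁) fun x hx => hx).trans ?_
    refine (mul_le_mul_right hG2 _).trans (le_of_eq ?_)
    have : (5 : ℝ≥0) ^ n * (C₂ * (γ * l)) * 2 ^ n = A * l / 2 * (10 ^ n * (2 * C₂ * γ / A)) := by
      rw [show (10 : ℝ≥0) = 5 * 2 by norm_num, mul_pow]
      field_simp
    have h' := congrArg (fun a : ℝ≥0 => (a : ℝ≥0∞) * volume Q.toSet) this
    simp only [ENNReal.coe_mul, ENNReal.coe_pow, ENNReal.coe_ofNat] at h' ⊢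
    refine Eq.trans ?_ (h'.trans ?_)
    · rw [hvol2]; ring
    · ring
  have vol2 : volume E₂ ≤ ((10 ^ n * (2 * C₁ * (5 ^ n + 1) / A) ^ p : ℝ≥0) : ℝ≥0∞) *
      volume Q.toSet := by
    rw [← ENNReal.mul_le_mul_iff_right hup0 ENNReal.coe_ne_top]
    refine (Q2.mul_volume_le_of_covered hn (E := E₂) fun x hx => hx).trans ?_
    refine (mul_le_mul_right hR2 _).trans (le_of_eq ?_)
    have : (5 : ℝ≥0) ^ n * (C₁ * ((5 ^ n + 1) * l)) ^ p * 2 ^ n =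
        (A * l / 2) ^ p * (10 ^ n * (2 * C₁ * (5 ^ n + 1) / A) ^ p) := by
      have e : C₁ * ((5 ^ n + 1) * l) = A * l / 2 * (2 * C₁ * (5 ^ n + 1) / A) := by field_simp
      rw [e, NNReal.mul_rpow, show (10 : ℝ≥0) = 5 * 2 by norm_num, mul_pow]
      ring
    have h' := congrArg (fun a : ℝ≥0 => (a : ℝ≥0∞) * volume Q.toSet) this
    simp only [ENNReal.coe_mul, ENNReal.coe_pow, ENNReal.coe_ofNat] at h' ⊢
    refine Eq.trans ?_ (h'.trans ?_)
    · rw [hvol2]; ring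
    · ring
  calc volume E ≤ volume E₁ + volume E₂ := (measure_mono hsub).trans (measure_union_le _ _)
    _ ≤ _ := add_le_add vol1 vol2
    _ = _ := by rw [← add_mul, ← ENNReal.coe_add, ← mul_add]

/-! ### Dyadic maximal functions and the stopping-time decomposition. -/

/-- The supremum over the dyadic cubes of `Q₀` containing `x` of the averages of `|f|` over the
cubes between this dyadic cube and `S`. -/
noncomputable def dyadicMaximal (Q₀ : AxisCube n) (S : Set (Fin n → ℝ)) (f : (Fin n → ℝ) → ℝ) :
    (Fin n → ℝ) → ℝ≥0∞ :=
  Q₀.halfOpen.indicator fun x => ⨆ k, (Q₀.gridCube k (Q₀.gridIndex k x)).supAverage S f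

theorem measurable_dyadicMaximal (Q₀ : AxisCube n) (S : Set (Fin n → ℝ))
    (f : (Fin n → ℝ) → ℝ) : Measurable (Q₀.dyadicMaximal S f) := by
  refine Measurable.indicator (Measurable.iSup fun k => ?_) Q₀.measurableSet_halfOpen
  exact (measurable_of_countable fun j => (Q₀.gridCube k j).supAverage S f).comp
    (Q₀.measurable_gridIndex k)

theorem lt_dyadicMaximal_iff {Q₀ : AxisCube n} {S : Set (Fin n → ℝ)} {f : (Fin n → ℝ) → ℝ}
    {x : Fin n → ℝ} {t : ℝ≥0∞} : t < Q₀.dyadicMaximal S f x ↔ x ∈ Q₀.halfOpen ∧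
      ∃ k, t < (Q₀.gridCube k (Q₀.gridIndex k x)).supAverage S f := by
  by_cases hx : x ∈ Q₀.halfOpen
  · rw [dyadicMaximal, Set.indicator_of_mem hx, lt_iSup_iff]
    simp [hx]
  · rw [dyadicMaximal, Set.indicator_of_notMem hx]
    simp [hx]

theorem supAverage_gridIndex_mono (Q₀ : AxisCube n) (S : Set (Fin n → ℝ))
    (f : (Fin n → ℝ) → ℝ) (x : Fin n → ℝ) :
    Monotone fun k => (Q₀.gridCube k (Q₀.gridIndex k x)).supAverage S f :=
  fun _ _ h => supAverage_anti (Q₀.gridCube_gridIndex_antitone x h) S f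

/-- Repeated halving of an index recovers all its ancestors, so quantities attached to coarser cubes
are constant on a finer piece. -/
theorem gridIndex_eq_of_le {Q₀ : AxisCube n} {k m : ℕ} (hkm : k ≤ m) {x y : Fin n → ℝ}
    (h : Q₀.gridIndex m x = Q₀.gridIndex m y) : Q₀.gridIndex k x = Q₀.gridIndex k y := by
  induction m, hkm using Nat.le_induction with
  | base => exact h
  | succ m _ ih =>
    refine ih (funext fun i => ?_)
    rw [← Q₀.gridIndex_succ_div_two m x, ← Q₀.gridIndex_succ_div_two m y, h]

/-- The stopping-time argument: a local distributional estimate on the maximal dyadic cubes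
on which the averages of `F` exceed `l` gives a good-`λ` inequality. -/
theorem measure_lt_dyadicMaximal_le (Q₀ : AxisCube n) (S : Set (Fin n → ℝ))
    (F f : (Fin n → ℝ) → ℝ) (μ : Measure (Fin n → ℝ)) {A l γ : ℝ≥0} (hA : 1 ≤ A) {θ : ℝ≥0∞}
    (hzero : ∀ x ∈ Q₀.halfOpen, (Q₀.gridCube 0 (Q₀.gridIndex 0 x)).supAverage S F ≤ l)
    (hloc : ∀ x ∈ Q₀.halfOpen, ∀ k,
      l < (Q₀.gridCube (k + 1) (Q₀.gridIndex (k + 1) x)).supAverage S F →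
      (Q₀.gridCube k (Q₀.gridIndex k x)).supAverage S F ≤ l →
      (Q₀.gridCube (k + 1) (Q₀.gridIndex (k + 1) x)).supAverage S f ≤ γ * l →
      μ ({y | Q₀.gridIndex (k + 1) y = Q₀.gridIndex (k + 1) x} ∩
          {y | A * l < Q₀.dyadicMaximal S F y}) ≤
        θ * μ {y | Q₀.gridIndex (k + 1) y = Q₀.gridIndex (k + 1) x}) :
    μ {x | A * l < Q₀.dyadicMaximal S F x} ≤
      θ * μ {x | l < Q₀.dyadicMaximal S F x} + μ {x | γ * l < Q₀.dyadicMaximal S f x} := by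
  set a : ((Fin n → ℝ) → ℝ) → ℕ → (Fin n → ℝ) → ℝ≥0∞ := fun g k x =>
    (Q₀.gridCube k (Q₀.gridIndex k x)).supAverage S g with ha
  have a_congr : ∀ g k m x y, k ≤ m → Q₀.gridIndex m x = Q₀.gridIndex m y → a g k x = a g k y :=
    fun g k m x y hkm h => by simp only [ha, gridIndex_eq_of_le hkm h]
  set piece : ℕ × (Fin n → ℤ) → Set (Fin n → ℝ) := fun z => {y | Q₀.gridIndex (z.1 + 1) y = z.2}
    with hpiece
  have piece_meas : ∀ z, MeasurableSet (piece z) := fun z =>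
    Q₀.measurable_gridIndex (z.1 + 1) (measurableSet_singleton z.2)
  -- A pair (k, j) stands for a cube of generation k + 1, with parent in generation k. By `hzero`
  -- generation 0 never exceeds l, so every stopping cube has a parent.
  set I : Set (ℕ × (Fin n → ℤ)) := {z | ∃ x ∈ Q₀.halfOpen, Q₀.gridIndex (z.1 + 1) x = z.2 ∧
    l < a F (z.1 + 1) x ∧ a F z.1 x ≤ l} with hI
  have hIc : I.Countable := Set.to_countable I
  have on_piece : ∀ z ∈ I, ∀ y ∈ piece z, y ∈ Q₀.halfOpen ∧ l < a F (z.1 + 1) y ∧ a F z.1 y ≤ l := by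
    rintro ⟨k, j⟩ ⟨x, hx, hj, h1, h2⟩ y hy
    obtain rfl : j = Q₀.gridIndex (k + 1) x := hj.symm
    refine ⟨?_, ?_, ?_⟩
    · have := gridIndex_eq_of_le (Nat.zero_le (k + 1)) hy
      exact this.trans hx
    · rw [a_congr F (k + 1) (k + 1) y x le_rfl hy]; exact h1
    · rw [a_congr F k (k + 1) y x (Nat.le_succ k) hy]; exact h2
  have hdisj : I.PairwiseDisjoint piece := by
    -- Suprema of averages increase with the generation, so at a given point the level l is crossed
    -- only once.
    have key : ∀ z ∈ I, ∀ z' ∈ I, ∀ y, y ∈ piece z → y ∈ piece z' → ¬ z.1 < z'.1 := by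
      intro z hz z' hz' y hy hy' hlt
      have h1 := (on_piece z hz y hy).2.1
      have h2 := (on_piece z' hz' y hy').2.2
      exact absurd (h1.trans_le ((Q₀.supAverage_gridIndex_mono S F y hlt).trans h2)) (lt_irrefl _)
    intro z hz z' hz' hne
    refine Set.disjoint_left.2 fun y hy hy' => hne ?_
    have h1 : z.1 = z'.1 := le_antisymm (not_lt.1 (key z' hz' z hz y hy' hy))
      (not_lt.1 (key z hz z' hz' y hy hy'))
    refine Prod.ext h1 ?_
    rw [← show Q₀.gridIndex (z.1 + 1) y = z.2 from hy,
      ← show Q₀.gridIndex (z'.1 + 1) y = z'.2 from hy', h1]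
  have hcov : {x | A * l < Q₀.dyadicMaximal S F x} ⊆ ⋃ z ∈ I, piece z := by
    classical
    intro x hx
    have hl : (l : ℝ≥0∞) < Q₀.dyadicMaximal S F x :=
      lt_of_le_of_lt (by exact_mod_cast le_mul_of_one_le_left zero_le hA) hx
    obtain ⟨hx0, hex⟩ := lt_dyadicMaximal_iff.1 hl
    obtain ⟨k, hk⟩ : ∃ k, Nat.find hex = k + 1 := by
      refine Nat.exists_eq_succ_of_ne_zero fun h0 => ?_
      have := Nat.find_spec hex
      rw [h0] at this
      exact this.not_ge (hzero x hx0)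
    refine Set.mem_biUnion (x := (k, Q₀.gridIndex (k + 1) x)) ⟨x, hx0, rfl, ?_, ?_⟩ rfl
    · have := Nat.find_spec hex
      rwa [hk] at this
    · exact not_lt.1 (Nat.find_min hex (by omega))
  have hlocal : ∀ z ∈ I, μ (piece z ∩ {x | A * l < Q₀.dyadicMaximal S F x}) ≤
      θ * μ (piece z) + μ (piece z ∩ {x | γ * l < Q₀.dyadicMaximal S f x}) := by
    rintro ⟨k, j⟩ ⟨x, hx, hj, h1, h2⟩
    obtain rfl : j = Q₀.gridIndex (k + 1) x := hj.symm
    -- If the averages of f are large at one point of the piece, they are large at all its points,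
    -- so the whole piece goes into the last term.
    by_cases h3 : a f (k + 1) x ≤ γ * l
    · exact (hloc x hx k h1 h2 h3).trans le_self_add
    · refine le_trans ?_ le_add_self
      refine measure_mono fun y hy => ⟨hy.1, ?_⟩
      refine lt_dyadicMaximal_iff.2 ⟨(on_piece (k, _) ⟨x, hx, rfl, h1, h2⟩ y hy.1).1, k + 1, ?_⟩
      change _ < a f (k + 1) y
      rw [a_congr f (k + 1) (k + 1) y x le_rfl hy.1]
      exact not_le.1 h3
  have hms : ∀ (g : (Fin n → ℝ) → ℝ) (t : ℝ≥0∞), MeasurableSet {x | t < Q₀.dyadicMaximal S g x} :=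
    fun g t => measurableSet_lt measurable_const (Q₀.measurable_dyadicMaximal S g)
  calc μ {x | A * l < Q₀.dyadicMaximal S F x}
      ≤ μ (⋃ z ∈ I, (piece z ∩ {x | A * l < Q₀.dyadicMaximal S F x})) := by
        refine measure_mono fun x hx => ?_
        rw [← Set.iUnion₂_inter]
        exact ⟨hcov hx, hx⟩
    _ ≤ ∑' z : I, μ (piece z ∩ {x | A * l < Q₀.dyadicMaximal S F x}) :=
        measure_biUnion_le μ hIc _
    _ ≤ ∑' z : I, (θ * μ (piece z) + μ (piece z ∩ {x | γ * l < Q₀.dyadicMaximal S f x})) :=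
        ENNReal.tsum_le_tsum fun z => hlocal z z.2
    _ = θ * μ (⋃ z ∈ I, piece z) +
          μ (⋃ z ∈ I, (piece z ∩ {x | γ * l < Q₀.dyadicMaximal S f x})) := by
        rw [ENNReal.tsum_add, ENNReal.tsum_mul_left,
          measure_biUnion hIc hdisj fun z _ => piece_meas z,
          measure_biUnion hIc (hdisj.mono fun z => Set.inter_subset_left)
            fun z _ => (piece_meas z).inter (hms f _)]
    _ ≤ _ := by
        gcongr
        · refine Set.iUnion₂_subset fun z hz y hy => ?_
          have := on_piece z hz y hy
          exact lt_dyadicMaximal_iff.2 ⟨this.1, _, this.2.1⟩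
        · exact Set.iUnion₂_subset fun z _ => Set.inter_subset_right

/-- Dyadic cubes over which the averages of `F` are large are small. -/
theorem side_le_of_lt_supAverage (hn : n ≠ 0) {Q Q₀ T : AxisCube n} (hT : T.side = 2 * Q₀.side)
    {F : (Fin n → ℝ) → ℝ} {L : ℝ} (hL : 0 < L) {l : ℝ≥0} (hl : 0 < l)
    (hlF : ENNReal.ofReal (L ^ n) * (⨍⁻ x in T.toSet, ‖F x‖ₑ ∂volume) ≤ l)
    (hQ : l < Q.supAverage T.toSet F) : Q.side ≤ 2 / L * Q₀.side := by
  obtain ⟨Q', hQQ', hQ'T, hQ'⟩ := lt_supAverage_iff.1 hQ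
  have hl0 : (l : ℝ≥0∞) ≠ 0 := by exact_mod_cast hl.ne'
  have h1 : volume T.toSet ≤ ENNReal.ofReal (2 ^ n) * volume Q₀.toSet :=
    volume_toSet_le_mul (by norm_num) hT.le
  -- By the choice of l, l |Q'| < ∫_T |F| ≤ l |T| / Lⁿ; hence L times the side of Q' is at most the
  -- side of T, which is twice that of Q₀.
  have h2 : (l : ℝ≥0∞) * (ENNReal.ofReal (L ^ n) * volume Q'.toSet) ≤ l * volume T.toSet := by
    rw [setLAverage_eq, ← mul_div_assoc,
      ENNReal.div_le_iff (volume_toSet_ne_zero _) (volume_toSet_ne_top _)] at hlF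
    refine le_trans ?_ hlF
    rw [mul_left_comm]
    gcongr
    exact hQ'.le.trans (lintegral_mono_set hQ'T)
  rw [ENNReal.mul_le_mul_iff_right hl0 ENNReal.coe_ne_top] at h2
  refine side_le_of_volume_le hn (by positivity) ?_
  have hLn : ENNReal.ofReal (L ^ n) ≠ 0 := by simp; positivity
  rw [← ENNReal.mul_le_mul_iff_right hLn ENNReal.ofReal_ne_top, ← mul_assoc,
    ← ENNReal.ofReal_mul (by positivity), ← mul_pow, mul_div_cancel₀ _ hL.ne']
  calc _ ≤ ENNReal.ofReal (L ^ n) * volume Q'.toSet := by gcongr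
    _ ≤ _ := h2.trans h1

/-- Lebesgue differentiation along the dyadic cubes of `Q₀`. -/
theorem ae_enorm_le_dyadicMaximal (Q₀ T : AxisCube n) (hT : Q₀.toSet ⊆ T.toSet)
    {F : (Fin n → ℝ) → ℝ} (hF : IntegrableOn F T.toSet) :
    ∀ᵐ x, x ∈ Q₀.halfOpen → ‖F x‖ₑ ≤ Q₀.dyadicMaximal T.toSet F x := by
  have hG : Integrable (T.toSet.indicator fun x => |F x|) :=
    (integrable_indicator_iff T.measurableSet_toSet).2 hF.abs
  -- With parameter 1 the closed balls need only contain x, not be centred there, as suits dyadic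
  -- cubes.
  filter_upwards [IsUnifLocDoublingMeasure.ae_tendsto_average volume hG.locallyIntegrable 1]
    with x hx hx0
  set Q : ℕ → AxisCube n := fun k => Q₀.gridCube k (Q₀.gridIndex k x) with hQ
  have hxQ : ∀ k, x ∈ (Q k).toSet := fun k => Q₀.mem_gridCube_gridIndex k x
  have hQT : ∀ k, (Q k).toSet ⊆ T.toSet := fun k => (Q₀.gridCube_subset hx0 k).trans hT
  have hlim : Filter.Tendsto (fun k => (Q k).side / 2) Filter.atTop (nhdsWithin 0 (Set.Ioi 0)) := by
    refine tendsto_nhdsWithin_iff.2 ⟨?_, Filter.Eventually.of_forall fun k => ?_⟩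
    · have h := (tendsto_pow_atTop_nhds_zero_of_lt_one (r := (1 / 2 : ℝ)) (by norm_num)
        (by norm_num)).const_mul (Q₀.side / 2)
      rw [mul_zero] at h
      refine h.congr fun k => ?_
      simp only [hQ, gridCube, one_div, inv_pow]
      ring
    · exact half_pos (Q k).side_pos
  have htend := hx (fun k => (Q k).center) (fun k => (Q k).side / 2) hlim
    (Filter.Eventually.of_forall fun k => by
      rw [one_mul, ← toSet_eq_closedBall]; exact hxQ k)
  have htend' := (ENNReal.continuous_ofReal.tendsto _).comp htend
  rw [Set.indicator_of_mem (hQT 0 (hxQ 0)), ← Real.enorm_eq_ofReal_abs] at htend'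
  refine le_of_tendsto' htend' fun k => ?_
  simp only [Function.comp_apply, ← toSet_eq_closedBall]
  rw [ofReal_setAverage hG.integrableOn
    (ae_of_all _ fun y => Set.indicator_nonneg (fun _ _ => abs_nonneg _) y)]
  rw [ENNReal.div_le_iff (volume_toSet_ne_zero _) (volume_toSet_ne_top _)]
  have h1 : ∫⁻ y in (Q k).toSet, ENNReal.ofReal (T.toSet.indicator (fun x => |F x|) y) =
      ∫⁻ y in (Q k).toSet, ‖F y‖ₑ := by
    refine setLIntegral_congr_fun (Q k).measurableSet_toSet fun y hy => ?_
    simp only [Set.indicator_of_mem (hQT k hy), Real.enorm_eq_ofReal_abs]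
  rw [h1]
  refine (lintegral_le_supAverage_mul F Set.Subset.rfl (hQT k)).trans ?_
  gcongr
  rw [dyadicMaximal, Set.indicator_of_mem hx0]
  exact le_iSup (fun k => (Q k).supAverage T.toSet F) k

/-! ### Choice of parameters and the weighted good-λ inequality. -/

/-- The choice of the parameters in the good-`λ` inequality. -/
theorem exists_goodLambda_parameters (n : ℕ) {p q η : ℝ} {B C₂ C₃ : ℝ≥0} (hq : 0 < q) (hp : 0 < p)
    (hη : q / p < η) (hB : 0 < B) (hC₂ : 0 < C₂) :
    ∃ A γ : ℝ≥0, 9 ^ n ≤ A ∧ 0 < γ ∧ γ ≤ 1 ∧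
      A ^ q * (C₃ * (10 ^ n * (2 * C₂ * γ / A + (B / A) ^ p)) ^ η) ≤ 1 / 2 := by
  have hη0 : 0 < η := (div_pos hq hp).trans hη
  have hexp : 0 < p * η - q := by
    rw [div_lt_iff₀ hp] at hη
    linarith
  -- Once γ makes the first summand at most (B / A)^p, the product is at most c A^(q - pη), whose
  -- exponent is negative.
  set c : ℝ≥0 := C₃ * (10 ^ n * (2 * B ^ p)) ^ η with hc
  have hlim : Filter.Tendsto (fun a : ℝ => (c : ℝ) * a ^ (-(p * η - q))) Filter.atTop (nhds 0) := by
    simpa using (tendsto_rpow_neg_atTop hexp).const_mul (c : ℝ)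
  obtain ⟨a, ha1, ha2⟩ := ((hlim.eventually (ge_mem_nhds (by norm_num : (0 : ℝ) < 1 / 2))).and
    (Filter.eventually_ge_atTop ((9 : ℝ) ^ n))).exists
  have ha0 : 0 < a := lt_of_lt_of_le (by positivity) ha2
  lift a to ℝ≥0 using ha0.le
  have hA0 : 0 < a := by exact_mod_cast ha0
  have hBa : 0 < (B / a) ^ p := NNReal.rpow_pos (div_pos hB hA0)
  -- This γ solves 2 C₂ γ / A = (B / A)^p, capped at 1.
  refine ⟨a, min 1 ((B / a) ^ p * a / (2 * C₂)), by exact_mod_cast ha2,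
    lt_min zero_lt_one (by positivity), min_le_left _ _, ?_⟩
  have h1 : 2 * C₂ * min 1 ((B / a) ^ p * a / (2 * C₂)) / a ≤ (B / a) ^ p := by
    rw [div_le_iff₀ hA0]
    calc 2 * C₂ * min 1 ((B / a) ^ p * a / (2 * C₂))
        ≤ 2 * C₂ * ((B / a) ^ p * a / (2 * C₂)) := by gcongr; exact min_le_right _ _
      _ = (B / a) ^ p * a := mul_div_cancel₀ _ (by positivity)
  calc a ^ q * (C₃ * (10 ^ n * (2 * C₂ * min 1 ((B / a) ^ p * a / (2 * C₂)) / a +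
          (B / a) ^ p)) ^ η)
      ≤ a ^ q * (C₃ * (10 ^ n * ((B / a) ^ p + (B / a) ^ p)) ^ η) := by gcongr
    _ = c * a ^ (-(p * η - q)) := by
        have e : (10 : ℝ≥0) ^ n * ((B / a) ^ p + (B / a) ^ p) =
            10 ^ n * (2 * B ^ p) * a ^ (-p) := by
          rw [NNReal.div_rpow, NNReal.rpow_neg]
          ring
        rw [e, NNReal.mul_rpow, ← NNReal.rpow_mul, hc,
          show -(p * η - q) = q + -p * η by ring, NNReal.rpow_add hA0.ne']
        ring
    _ ≤ 1 / 2 := by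
        rw [← NNReal.coe_le_coe]
        push_cast
        exact ha1

/-- An `A_q` weight agrees almost everywhere with a measurable, everywhere positive and finite
one. -/
theorem exists_isRegularWeight {q : ℝ} (hq : 1 < q) {K : ℝ≥0} {T : AxisCube n}
    {ω : (Fin n → ℝ) → ℝ} (hω : IsMuckenhouptWeightOn q K T.toSet ω) :
    ∃ w : (Fin n → ℝ) → ℝ≥0∞, IsRegularWeight q K T w ∧
      ∀ᵐ x ∂volume.restrict T.toSet, ENNReal.ofReal (ω x) = w x := by
  have hm := hω.integrableOn.aestronglyMeasurable.aemeasurable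
  set v := hm.mk ω with hv
  have hvm : Measurable v := hm.measurable_mk
  have hae : ∀ᵐ x ∂volume.restrict T.toSet, ENNReal.ofReal (ω x) =
      (if 0 < v x then ENNReal.ofReal (v x) else 1) := by
    filter_upwards [hω.pos, hm.ae_eq_mk] with x hx hx'
    rw [← hv] at hx'
    rw [← hx', if_pos hx]
  -- Replacing the nonpositive values of the representative by 1 changes nothing almost everywhere
  -- in T.
  refine ⟨fun x => if 0 < v x then ENNReal.ofReal (v x) else 1, ⟨hq, ?_, fun x => ?_, fun x => ?_,
    ?_, fun Q hQ => ?_⟩, hae⟩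
  · exact Measurable.ite (measurableSet_lt measurable_const hvm) hvm.ennreal_ofReal
      measurable_const
  · split_ifs with h
    · simpa using h
    · exact one_ne_zero
  · split_ifs
    · exact ENNReal.ofReal_ne_top
    · exact ENNReal.one_ne_top
  · rw [← lintegral_congr_ae hae]
    exact ((lintegral_ofReal_le_lintegral_enorm ω).trans_lt hω.integrableOn.2).ne
  · have haeQ := ae_restrict_of_ae_restrict_of_subset hQ hae
    have hb := hω.bound Q hQ
    have hq1 : 0 < q - 1 := by linarith
    have hv0 := Q.volume_toSet_ne_zero
    have hv1 := Q.volume_toSet_ne_top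
    rw [setLAverage_eq, setLAverage_eq, lintegral_congr_ae haeQ,
      lintegral_congr_ae (haeQ.mono fun x hx => congrArg (· ^ (-(1 / (q - 1)))) hx),
      ENNReal.div_rpow_of_nonneg _ _ hq1.le] at hb
    have hvq0 : volume Q.toSet ^ (q - 1) ≠ 0 :=
      (ENNReal.rpow_pos Q.volume_toSet_pos hv1).ne'
    have hvq1 : volume Q.toSet ^ (q - 1) ≠ ∞ := ENNReal.rpow_ne_top_of_nonneg hq1.le hv1
    have hvol : volume Q.toSet ^ q = volume Q.toSet * volume Q.toSet ^ (q - 1) := by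
      rw [show q = 1 + (q - 1) by ring, ENNReal.rpow_add_of_nonneg _ _ zero_le_one hq1.le,
        ENNReal.rpow_one, add_sub_cancel_left]
    rw [hvol, ← ENNReal.div_le_iff (mul_ne_zero hv0 hvq0) (ENNReal.mul_ne_top hv1 hvq1)]
    refine le_trans (le_of_eq ?_) hb
    simp only [div_eq_mul_inv (G := ℝ≥0∞), ENNReal.mul_inv (Or.inl hv0) (Or.inl hv1)]
    ring

theorem toSet_subset_dilate_two (Q : AxisCube n) : Q.toSet ⊆ Q.dilate 2 := by
  intro x hx i
  linarith [hx i, Q.side_pos]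

/-- A concentric dilate of a small subcube of `Q₀` lies in `2Q₀`. -/
theorem dilate_subset_dilate_two {Q Q₀ : AxisCube n} (hQ : Q.toSet ⊆ Q₀.toSet) {α : ℝ}
    (h : α * Q.side ≤ Q₀.side) : Q.dilate α ⊆ Q₀.dilate 2 := by
  have hc : Q.center ∈ Q.toSet := by
    rw [toSet_eq_closedBall]; exact Metric.mem_closedBall_self (by linarith [Q.side_pos])
  intro x hx i
  have h1 := hx i
  have h2 := hQ hc i
  have h3 := abs_sub_le (x i) (Q.center i) (Q₀.center i)
  linarith

/-- The good-`λ` inequality for the dyadic maximal functions of `F` and `f`. -/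
theorem goodLambda_dyadicMaximal (hn : n ≠ 0) {p α β η : ℝ} {C₁ C₂ C₃ : ℝ≥0} (hp : 1 < p)
    (hα : 1 < α) (hβ₀ : 0 < β) (hβ₁ : β < 1) (hη : 0 < η) {Q₀ T : AxisCube n}
    (hT : T = Q₀.scale 2 two_pos) {F f ω : (Fin n → ℝ) → ℝ} {w : (Fin n → ℝ) → ℝ≥0∞}
    (hdec : ∀ Q : AxisCube n, Q.IsDyadicSubcube Q₀ →
      volume Q.toSet ≤ ENNReal.ofReal β * volume Q₀.toSet →
      Q.dilate α ⊆ Q₀.dilate 2 →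
      ∃ F_Q R_Q : (Fin n → ℝ) → ℝ,
        IntegrableOn F_Q (Q.dilate 2) ∧
        IntegrableOn R_Q (Q.dilate 2) ∧
        (∀ᵐ x ∂(volume.restrict (Q.dilate 2)), |F x| ≤ |F_Q x| + |R_Q x|) ∧
        (⨍⁻ x in Q.dilate 2, ‖R_Q x‖ₑ ^ p ∂volume) ^ (1 / p) ≤
          C₁ * ((⨍⁻ x in Q.dilate α, ‖F x‖ₑ ∂volume) + Q.supAverage (Q₀.dilate 2) f) ∧
        (⨍⁻ x in Q.dilate 2, ‖F_Q x‖ₑ ∂volume) ≤ C₂ * Q.supAverage (Q₀.dilate 2) f)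
    (hω : ∀ (Q : AxisCube n) (E : Set (Fin n → ℝ)),
      Q.toSet ⊆ Q₀.toSet → E ⊆ Q.toSet → MeasurableSet E →
      weightMass ω E / weightMass ω Q.toSet ≤ C₃ * (volume E / volume Q.toSet) ^ η)
    (hw0 : ∀ Q : AxisCube n, ∫⁻ x in Q.toSet, w x ≠ 0)
    (hwT : ∫⁻ x in T.toSet, w x ≠ ∞)
    (hwω : ∀ᵐ x ∂volume.restrict T.toSet, ENNReal.ofReal (ω x) = w x)
    {A l γ : ℝ≥0} (hA : 9 ^ n ≤ A) (hl : 0 < l) (hγ : γ ≤ 1)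
    (hlF : ENNReal.ofReal ((2 * α / β) ^ n) * (⨍⁻ x in T.toSet, ‖F x‖ₑ ∂volume) ≤ l) :
    ((volume.withDensity w).restrict T.toSet) {x | A * l < Q₀.dyadicMaximal T.toSet F x} ≤
      (C₃ * (10 ^ n * (2 * C₂ * γ / A + (2 * C₁ * (5 ^ n + 1) / A) ^ p)) ^ η : ℝ≥0) *
          ((volume.withDensity w).restrict T.toSet) {x | l < Q₀.dyadicMaximal T.toSet F x} +
        ((volume.withDensity w).restrict T.toSet) {x | γ * l < Q₀.dyadicMaximal T.toSet f x} := by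
  have hTs : T.toSet = Q₀.dilate 2 := by rw [hT]; rfl
  have hQ₀T : Q₀.toSet ⊆ T.toSet := hTs ▸ Q₀.toSet_subset_dilate_two
  have hL : 0 < 2 * α / β := by positivity
  have hs0 := Q₀.side_pos
  -- The factor 2α/β forces the selected cubes to have side at most β/α times that of Q₀, which
  -- gives both αQ ⊆ 2Q₀ and |Q| ≤ β|Q₀|, and excludes Q₀ itself.
  have hLβ : 2 / (2 * α / β) = β / α := by field_simp
  have hβα : β / α < 1 := by rw [div_lt_one (by linarith)]; linarith
  have small : ∀ Q : AxisCube n, l < Q.supAverage T.toSet F → Q.side ≤ β / α * Q₀.side := by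
    intro Q hQ
    rw [← hLβ]
    exact side_le_of_lt_supAverage hn (by rw [hT]; rfl) hL hl hlF hQ
  have hA1 : 1 ≤ A := (one_le_pow₀ (by norm_num)).trans hA
  refine measure_lt_dyadicMaximal_le Q₀ T.toSet F f _ hA1 ?_ ?_
  · intro x _
    by_contra! h
    have h1 := small _ h
    rw [show (Q₀.gridCube 0 (Q₀.gridIndex 0 x)).side = Q₀.side by simp [gridCube]] at h1
    nlinarith
  · intro x hx k hlarge hparent hf
    set Q := Q₀.gridCube (k + 1) (Q₀.gridIndex (k + 1) x) with hQ
    set P := Q₀.gridCube k (Q₀.gridIndex k x) with hP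
    have hQs := Q.side_pos
    have hQP : Q.toSet ⊆ P.toSet := Q₀.gridCube_gridIndex_antitone x (Nat.le_succ k)
    have hPQ₀ : P.toSet ⊆ Q₀.toSet := Q₀.gridCube_subset hx k
    have hside : Q.side ≤ β / α * Q₀.side := small Q hlarge
    have hαs : α * Q.side ≤ Q₀.side := by
      calc α * Q.side ≤ α * (β / α * Q₀.side) := by gcongr
        _ = β * Q₀.side := by field_simp
        _ ≤ Q₀.side := by nlinarith
    have hαQ : Q.dilate α ⊆ Q₀.dilate 2 :=
      dilate_subset_dilate_two (hQP.trans hPQ₀) hαs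
    have hvolQ : volume Q.toSet ≤ ENNReal.ofReal β * volume Q₀.toSet := by
      refine (volume_toSet_le_mul (by positivity) hside).trans ?_
      gcongr
      have hβα' : β / α ≤ β := div_le_self hβ₀.le hα.le
      exact (pow_le_of_le_one (by positivity) hβα.le hn).trans hβα'
    obtain ⟨G, R, hG, hR, hFGR, hRp, hG1⟩ :=
      hdec Q (Q₀.isDyadicSubcube_gridCube hx (k + 1)) hvolQ hαQ
    rw [← hTs] at hRp hG1 hαQ
    set piece : Set (Fin n → ℝ) := {y | Q₀.gridIndex (k + 1) y = Q₀.gridIndex (k + 1) x}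
      with hpiece
    have hpiece_meas : MeasurableSet piece :=
      Q₀.measurable_gridIndex (k + 1) (measurableSet_singleton _)
    have hpQ : piece ⊆ Q.toSet := Q₀.gridPiece_subset (k + 1) _
    set E := piece ∩ {y | A * l < Q₀.dyadicMaximal T.toSet F y} with hE
    have hEm : MeasurableSet E := hpiece_meas.inter
      (measurableSet_lt measurable_const (Q₀.measurable_dyadicMaximal _ F))
    have hEQ : E ⊆ Q.toSet := Set.inter_subset_left.trans hpQ
    have hvolE := volume_le_of_local_decomposition hn hp hα hQP (hPQ₀.trans hQ₀T)
      (show P.side = 2 * Q.side by simp only [hP, hQ, gridCube]; field_simp; ring)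
      hαQ hA hl hγ hparent hf hG hR hFGR hRp hG1 (E := E) (by
        rintro y ⟨hy1, hy2⟩
        refine ⟨hpQ hy1, ?_⟩
        obtain ⟨_, m, hm⟩ := lt_dyadicMaximal_iff.1 hy2
        obtain ⟨Q', h1, h2, h3⟩ := lt_supAverage_iff.1 hm
        exact ⟨Q', h1 (Q₀.mem_gridCube_gridIndex m y), h2, h3⟩)
    have mass_eq : ∀ U ⊆ Q.toSet, MeasurableSet U →
        weightMass ω U = ((volume.withDensity w).restrict T.toSet) U := by
      intro U hU hUm
      have hUT : U ⊆ T.toSet := hU.trans ((hQP.trans hPQ₀).trans hQ₀T)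
      rw [Measure.restrict_apply hUm, Set.inter_eq_self_of_subset_left hUT,
        withDensity_apply _ hUm, weightMass]
      exact lintegral_congr_ae (ae_restrict_of_ae_restrict_of_subset hUT hwω)
    have hmQ : ((volume.withDensity w).restrict T.toSet) Q.toSet = ∫⁻ x in Q.toSet, w x := by
      rw [Measure.restrict_apply Q.measurableSet_toSet,
        Set.inter_eq_self_of_subset_left ((hQP.trans hPQ₀).trans hQ₀T),
        withDensity_apply _ Q.measurableSet_toSet]
    have hmQ0 : ((volume.withDensity w).restrict T.toSet) Q.toSet ≠ 0 := by rw [hmQ]; exact hw0 Q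
    have hmQ1 : ((volume.withDensity w).restrict T.toSet) Q.toSet ≠ ∞ := by
      rw [hmQ]
      exact ne_top_of_le_ne_top hwT (lintegral_mono_set ((hQP.trans hPQ₀).trans hQ₀T))
    -- The stopping pieces are half-open whereas the local estimates are on closed cubes; the
    -- boundaries are null for the weight too.
    have hpm : ((volume.withDensity w).restrict T.toSet) piece =
        ((volume.withDensity w).restrict T.toSet) Q.toSet :=
      measure_congr ((Measure.restrict_le_self.absolutelyContinuous.trans
        (withDensity_absolutelyContinuous _ _)).ae_eq (Q₀.gridPiece_ae_eq hn (k + 1) _))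
    have hmain := hω Q E (hQP.trans hPQ₀) hEQ hEm
    rw [mass_eq E hEQ hEm, mass_eq _ Set.Subset.rfl Q.measurableSet_toSet,
      ENNReal.div_le_iff hmQ0 hmQ1] at hmain
    rw [hpm]
    refine hmain.trans ?_
    gcongr
    rw [ENNReal.coe_mul, ENNReal.coe_rpow_of_nonneg _ hη.le]
    gcongr
    rwa [ENNReal.div_le_iff Q.volume_toSet_ne_zero Q.volume_toSet_ne_top]

/-- The weighted estimate for `F` with explicit constants, for a fixed regular version `w` of the
weight. -/
theorem lintegral_enorm_rpow_mul_le (hn : n ≠ 0) {q : ℝ} {K : ℝ≥0} {Q₀ T : AxisCube n}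
    (hQ₀T : Q₀.toSet ⊆ T.toSet) {F f : (Fin n → ℝ) → ℝ} {w : (Fin n → ℝ) → ℝ≥0∞}
    (hw : IsRegularWeight q K T w) (hF : IntegrableOn F T.toSet)
    (hf : AEMeasurable f (volume.restrict T.toSet))
    {A l₀ γ : ℝ≥0} {θ : ℝ≥0∞} (hA : 1 ≤ A) (hγ : 0 < γ) (hθ : (A : ℝ≥0∞) ^ q * θ ≤ 1 / 2)
    (H : ∀ l : ℝ≥0, l₀ < l →
      ((volume.withDensity w).restrict T.toSet) {x | A * l < Q₀.dyadicMaximal T.toSet F x} ≤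
        θ * ((volume.withDensity w).restrict T.toSet) {x | l < Q₀.dyadicMaximal T.toSet F x} +
        ((volume.withDensity w).restrict T.toSet) {x | γ * l < Q₀.dyadicMaximal T.toSet f x}) :
    ∫⁻ x in Q₀.toSet, ‖F x‖ₑ ^ q * w x ≤
      2 * (A : ℝ≥0∞) ^ q * (l₀ ^ q * (∫⁻ x in T.toSet, w x) +
        ((γ : ℝ≥0∞) ^ q)⁻¹ * (weightedMaximalConst n q K *
          ∫⁻ x in T.toSet, ‖f x‖ₑ ^ q * w x)) := by
  have hq0 : 0 < q := by linarith [hw.one_lt]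
  set μ := (volume.withDensity w).restrict T.toSet with hμ
  have hμuniv : μ Set.univ = ∫⁻ x in T.toSet, w x := by
    rw [hμ, Measure.restrict_apply_univ, withDensity_apply _ T.measurableSet_toSet]
  have : IsFiniteMeasure μ := ⟨by rw [hμuniv]; exact hw.lintegral_ne_top.lt_top⟩
  have hDF := Q₀.measurable_dyadicMaximal T.toSet F
  have hDf := Q₀.measurable_dyadicMaximal T.toSet f
  have hγ0 : (γ : ℝ≥0∞) ≠ 0 := by exact_mod_cast hγ.ne'
  -- Dividing the second maximal function by γ brings its level γ * l back to l.
  have good := lintegral_rpow_le_of_goodLambda μ hDF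
    (m := fun x => Q₀.dyadicMaximal T.toSet f x / γ) (hDf.div_const _) hq0 hA hθ
    (fun t ht => by
      simpa only [ENNReal.lt_div_iff_mul_lt (Or.inl hγ0) (Or.inl ENNReal.coe_ne_top),
        mul_comm (γ : ℝ≥0∞)] using H t ht)
  have hleft : ∫⁻ x in Q₀.toSet, ‖F x‖ₑ ^ q * w x ≤
      ∫⁻ x, Q₀.dyadicMaximal T.toSet F x ^ q ∂μ := by
    rw [hμ, setLIntegral_withDensity_eq_setLIntegral_mul _ hw.measurable (hDF.pow_const _)
      T.measurableSet_toSet, ← Measure.restrict_congr_set (Q₀.halfOpen_ae_eq hn)]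
    refine le_trans ?_ (lintegral_mono_set (Q₀.halfOpen_subset.trans hQ₀T))
    refine lintegral_mono_ae ?_
    filter_upwards [ae_restrict_mem Q₀.measurableSet_halfOpen,
      ae_restrict_of_ae (Q₀.ae_enorm_le_dyadicMaximal T hQ₀T hF)] with x hx hx'
    rw [Pi.mul_apply, mul_comm]
    gcongr
    exact hx' hx
  have hgm : Measurable fun x => ‖hf.mk f x‖ₑ := hf.measurable_mk.enorm
  have hfae : ∀ᵐ x ∂volume.restrict T.toSet, ‖f x‖ₑ = ‖hf.mk f x‖ₑ :=
    hf.ae_eq_mk.mono fun x hx => by rw [← hx]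
  have hmax : ∫⁻ x, Q₀.dyadicMaximal T.toSet f x ^ q * w x ≤
      weightedMaximalConst n q K * ∫⁻ x in T.toSet, ‖f x‖ₑ ^ q * w x := by
    rw [lintegral_congr_ae (hfae.mono fun x hx => congrArg (· ^ q * w x) hx)]
    refine hw.lintegral_rpow_mul_le hn hDf hgm fun x t ht => ?_
    obtain ⟨_, k, hk⟩ := lt_dyadicMaximal_iff.1 ht
    obtain ⟨Q', h1, h2, h3⟩ := lt_supAverage_iff.1 hk
    refine ⟨Q', h1 (Q₀.mem_gridCube_gridIndex k x), h2, h3.le.trans (le_of_eq ?_)⟩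
    exact lintegral_congr_ae (ae_restrict_of_ae_restrict_of_subset h2 hfae)
  have hright : ∫⁻ x, (Q₀.dyadicMaximal T.toSet f x / γ) ^ q ∂μ ≤
      ((γ : ℝ≥0∞) ^ q)⁻¹ * (weightedMaximalConst n q K *
          ∫⁻ x in T.toSet, ‖f x‖ₑ ^ q * w x) := by
    refine le_trans ?_ (mul_le_mul_right hmax _)
    have hDw : Measurable fun x => Q₀.dyadicMaximal T.toSet f x ^ q * w x :=
      (hDf.pow_const _).mul hw.measurable
    rw [hμ, setLIntegral_withDensity_eq_setLIntegral_mul _ hw.measurable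
      ((hDf.div_const _).pow_const _) T.measurableSet_toSet, ← lintegral_const_mul _ hDw]
    refine (setLIntegral_le_lintegral _ _).trans (le_of_eq (lintegral_congr fun x => ?_))
    rw [Pi.mul_apply, ENNReal.div_rpow_of_nonneg _ _ hq0.le, div_eq_mul_inv]
    ring
  refine hleft.trans (good.trans ?_)
  rw [hμuniv]
  gcongr

end AxisCube

/-! ### Constants and conclusion. -/

open AxisCube in
theorem theorem3p4 (n : ℕ) (hn : 1 ≤ n) (p q α β η : ℝ) (C₁ C₂ C₃ K : ℝ≥0)
    (hq : 1 < q) (hqp : q < p) (hα : 1 < α) (hβ₀ : 0 < β) (hβ₁ : β < 1) (hη : q / p < η)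
    (hC₁ : 0 < C₁) (hC₂ : 0 < C₂) :
    ∃ C : ℝ≥0, 0 < C ∧
      ∀ (Q₀ : AxisCube n) (F f ω : (Fin n → ℝ) → ℝ),
        IntegrableOn F (Q₀.dilate 2) →
        MemLp f (ENNReal.ofReal q) (volume.restrict (Q₀.dilate 2)) →
        (∀ Q : AxisCube n, Q.IsDyadicSubcube Q₀ →
          volume Q.toSet ≤ ENNReal.ofReal β * volume Q₀.toSet →
          Q.dilate α ⊆ Q₀.dilate 2 →
          ∃ F_Q R_Q : (Fin n → ℝ) → ℝ,
            IntegrableOn F_Q (Q.dilate 2) ∧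
            IntegrableOn R_Q (Q.dilate 2) ∧
            (∀ᵐ x ∂(volume.restrict (Q.dilate 2)), |F x| ≤ |F_Q x| + |R_Q x|) ∧
            (⨍⁻ x in Q.dilate 2, ‖R_Q x‖ₑ ^ p ∂volume) ^ (1 / p) ≤
              C₁ * ((⨍⁻ x in Q.dilate α, ‖F x‖ₑ ∂volume) + Q.supAverage (Q₀.dilate 2) f) ∧
            (⨍⁻ x in Q.dilate 2, ‖F_Q x‖ₑ ∂volume) ≤ C₂ * Q.supAverage (Q₀.dilate 2) f) →
        IsMuckenhouptWeightOn q K (Q₀.dilate 2) ω →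
        (∀ (Q : AxisCube n) (E : Set (Fin n → ℝ)),
          Q.toSet ⊆ Q₀.toSet → E ⊆ Q.toSet → MeasurableSet E →
          weightMass ω E / weightMass ω Q.toSet ≤
            C₃ * (volume E / volume Q.toSet) ^ η) →
        weightedLqAverage q ω Q₀.toSet F ≤
          C * (⨍⁻ x in Q₀.dilate 2, ‖F x‖ₑ ∂volume) +
            C * weightedLqAverage q ω (Q₀.dilate 2) f := by
  have hn0 : n ≠ 0 := by omega
  have hq0 : 0 < q := by linarith
  have hp : 1 < p := by linarith
  have hη0 : 0 < η := (div_pos hq0 (by linarith)).trans hη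
  have hL : 0 < 2 * α / β := by positivity
  obtain ⟨A, γ, hA, hγ0, hγ1, hpar⟩ := exists_goodLambda_parameters n (B := 2 * C₁ * (5 ^ n + 1))
    (C₃ := C₃) hq0 (by linarith) hη (by positivity) hC₂
  set θ : ℝ≥0 := C₃ * (10 ^ n * (2 * C₂ * γ / A + (2 * C₁ * (5 ^ n + 1) / A) ^ p)) ^ η with hθ
  have hA1 : 1 ≤ A := (one_le_pow₀ (by norm_num)).trans hA
  set M := weightedMaximalConst n q K with hM
  -- The doubling constant of the weight from Q₀ to 2Q₀.
  set D : ℝ≥0∞ := K * ENNReal.ofReal (2 ^ n) ^ q with hD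
  set X : ℝ≥0∞ := 2 * (A : ℝ≥0∞) ^ q * (D * (1 + ((γ : ℝ≥0∞) ^ q)⁻¹ * M)) with hX
  have hD1 : D ≠ ∞ := ENNReal.mul_ne_top ENNReal.coe_ne_top
    (ENNReal.rpow_ne_top_of_nonneg hq0.le ENNReal.ofReal_ne_top)
  have hX1 : X ≠ ∞ := by
    have h1 : ((γ : ℝ≥0∞) ^ q)⁻¹ ≠ ∞ := by
      rw [ENNReal.inv_ne_top]
      exact (ENNReal.rpow_pos (by exact_mod_cast hγ0) ENNReal.coe_ne_top).ne'
    exact ENNReal.mul_ne_top (ENNReal.mul_ne_top (by simp)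
      (ENNReal.rpow_ne_top_of_nonneg hq0.le ENNReal.coe_ne_top)) (ENNReal.mul_ne_top hD1
      (ENNReal.add_ne_top.2 ⟨by simp, ENNReal.mul_ne_top h1 (weightedMaximalConst_ne_top n hq K)⟩))
  set L : ℝ≥0∞ := ENNReal.ofReal ((2 * α / β) ^ n) with hLdef
  -- The factor L + 1 lets one constant serve both terms; the final 1 only ensures positivity.
  set Y : ℝ≥0∞ := X ^ (1 / q) * (L + 1) + 1 with hY
  have hY1 : Y ≠ ∞ := by
    refine ENNReal.add_ne_top.2 ⟨ENNReal.mul_ne_top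
      (ENNReal.rpow_ne_top_of_nonneg (by positivity) hX1)
      (ENNReal.add_ne_top.2 ⟨ENNReal.ofReal_ne_top, by simp⟩), by simp⟩
  refine ⟨Y.toNNReal, ENNReal.toNNReal_pos (by simp [hY]) hY1, ?_⟩
  intro Q₀ F f ω hF hf hdec hω hωη
  rw [ENNReal.coe_toNNReal hY1]
  set T := Q₀.scale 2 two_pos with hT
  have hTs : Q₀.dilate 2 = T.toSet := rfl
  have hQ₀T : Q₀.toSet ⊆ T.toSet := Q₀.toSet_subset_dilate_two
  rw [hTs] at hF hf hω ⊢
  obtain ⟨w, hw, hwω⟩ := exists_isRegularWeight hq hω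
  set a : ℝ≥0∞ := ⨍⁻ x in T.toSet, ‖F x‖ₑ ∂volume with ha
  have haT : a ≠ ∞ := by
    rw [ha, setLAverage_eq]
    exact ENNReal.div_ne_top hF.2.ne T.volume_toSet_ne_zero
  have hLa : L * a ≠ ∞ := ENNReal.mul_ne_top ENNReal.ofReal_ne_top haT
  -- The threshold l₀ is L times the average of |F| over 2Q₀, the level above which the stopping
  -- cubes are small.
  have main := lintegral_enorm_rpow_mul_le hn0 hQ₀T hw hF hf.1.aemeasurable
    (A := A) (l₀ := (L * a).toNNReal) (γ := γ) (θ := θ) hA1 hγ0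
    (by
      rw [← ENNReal.coe_rpow_of_nonneg _ hq0.le, ← ENNReal.coe_mul]
      refine (ENNReal.coe_le_coe.2 hpar).trans (le_of_eq ?_)
      simp)
    (fun l hl => goodLambda_dyadicMaximal hn0 hp hα hβ₀ hβ₁ hη0 hT hdec hωη hw.mass_ne_zero
      hw.lintegral_ne_top hwω hA (zero_le.trans_lt hl) hγ1
      ((ENNReal.coe_toNNReal hLa).symm.le.trans (by exact_mod_cast hl.le)))
  rw [ENNReal.coe_toNNReal hLa] at main
  have hwQ₀ := ae_restrict_of_ae_restrict_of_subset hQ₀T hwω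
  set W := ∫⁻ x in Q₀.toSet, w x with hW
  set V := ∫⁻ x in T.toSet, w x with hV
  have hW0 : W ≠ 0 := hw.mass_ne_zero Q₀
  have hW1 : W ≠ ∞ := hw.mass_ne_top hQ₀T
  have hV0 : V ≠ 0 := hw.mass_ne_zero T
  have hV1 : V ≠ ∞ := hw.lintegral_ne_top
  have hVW : V ≤ D * W := hw.mass_le_of_side_le hQ₀T Set.Subset.rfl two_pos.le le_rfl
  set I := ∫⁻ x in T.toSet, ‖f x‖ₑ ^ q * w x with hI
  have eF : weightedLqAverage q ω Q₀.toSet F =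
      ((∫⁻ x in Q₀.toSet, ‖F x‖ₑ ^ q * w x) / W) ^ (1 / q) := by
    rw [weightedLqAverage, weightMass, lintegral_congr_ae hwQ₀,
      lintegral_congr_ae (hwQ₀.mono fun x hx => congrArg (‖F x‖ₑ ^ q * ·) hx)]
  have ef : weightedLqAverage q ω T.toSet f = (I / V) ^ (1 / q) := by
    rw [weightedLqAverage, weightMass, lintegral_congr_ae hwω,
      lintegral_congr_ae (hwω.mono fun x hx => congrArg (‖f x‖ₑ ^ q * ·) hx)]
  have hIV : I = I / V * V := (ENNReal.div_mul_cancel hV0 hV1).symm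
  have bound : (∫⁻ x in Q₀.toSet, ‖F x‖ₑ ^ q * w x) / W ≤ X * ((L * a) ^ q + I / V) := by
    rw [ENNReal.div_le_iff hW0 hW1]
    calc _ ≤ _ := main
      _ = 2 * (A : ℝ≥0∞) ^ q * (((L * a) ^ q + ((γ : ℝ≥0∞) ^ q)⁻¹ * (M * (I / V))) * V) := by
          conv_lhs => rw [hIV]
          ring
      _ ≤ 2 * (A : ℝ≥0∞) ^ q * (((L * a) ^ q + ((γ : ℝ≥0∞) ^ q)⁻¹ * (M * (I / V))) *
          (D * W)) := by gcongr
      -- The nonnegative terms added here complete the product (1 + γ^(-q) M) ((L a)^q + I / V).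
      _ ≤ 2 * (A : ℝ≥0∞) ^ q * ((((L * a) ^ q + ((γ : ℝ≥0∞) ^ q)⁻¹ * (M * (I / V))) +
          (((γ : ℝ≥0∞) ^ q)⁻¹ * M * (L * a) ^ q + I / V)) * (D * W)) :=
          mul_le_mul_right (mul_le_mul_left le_self_add _) _
      _ = _ := by rw [hX]; ring
  have hq1 : 0 ≤ 1 / q := by positivity
  have hq1' : 1 / q ≤ 1 := by rw [div_le_one hq0]; exact hq.le
  rw [eF, ef]
  calc _ ≤ (X * ((L * a) ^ q + I / V)) ^ (1 / q) := ENNReal.rpow_le_rpow bound hq1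
    _ ≤ X ^ (1 / q) * (((L * a) ^ q) ^ (1 / q) + (I / V) ^ (1 / q)) := by
        rw [ENNReal.mul_rpow_of_nonneg _ _ hq1]
        gcongr
        exact ENNReal.rpow_add_le_add_rpow _ _ hq1 hq1'
    _ = X ^ (1 / q) * L * a + X ^ (1 / q) * (I / V) ^ (1 / q) := by
        rw [← ENNReal.rpow_mul, mul_one_div_cancel hq0.ne', ENNReal.rpow_one]
        ring
    _ ≤ Y * a + Y * (I / V) ^ (1 / q) := by
        gcongr
        · rw [hY, mul_add, add_assoc]; exact le_self_add
        · rw [hY, mul_add, mul_one, add_assoc, add_left_comm]; exact le_self_add
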